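/- Let $k$ be an algebraically closed field and let $R = k[x,y,z,w]$ be bigraded with $x, y$ of degree $(1,0)$ and $z, w$ of degree $(0,1)$; $R_{m,n}$ denotes the piece of degree $(m,n)$. Let $p_0, p_1, p_2 \in R_{2,1}$ have no common zero on $\mathbb{P}^1 \times \mathbb{P}^1$, and let $$\mathrm{Syz}(p) = \{(A_0,A_1,A_2) \in R^3 : A_0p_0 + A_1p_1 + A_2p_2 = 0\} \subset R(-2,-1)^3,$$ graded so that a syzygy $(A_0,A_1,A_2)$ has degree $(m,n)$ when $A_0,A_1,A_2$ are bihomogeneous of degree $(m-2,n-1)$. Let $W(p) = \mathbb{P}(\mathrm{Span}(p_0,p_1,p_2)) \subset \mathbb{P}(R_{2,1})$, and let $Y \subset \mathbb{P}(R_{2,1})$ be the image of the Segre embedding $\mathbb{P}(R_{2,0}) \times \mathbb{P}(R_{0,1}) \to \mathbb{P}(R_{2,1})$ given by multiplication. Call $p_0,p_1,p_2$ generic if $W(p) \cap Y$ is finite, and non-generic if it is infinite. A minimal set of bihomogeneous generators of $\mathrm{Syz}(p)$ is a set of bihomogeneous elements that generates $\mathrm{Syz}(p)$ as an $R$-module and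 no proper subset of which generates it. Then minimal sets of bihomogeneous generators of $\mathrm{Syz}(p)$ exist, and: 1. if $p_0,p_1,p_2$ are generic, every such set has exactly six elements: one of degree $(6,1)$, three of degree $(4,2)$ and two of degree $(3,3)$; 2. if $p_0,p_1,p_2$ are non-generic, every such set has exactly five elements: one of degree $(6,1)$, three of degree $(4,2)$ and one of degree $(2,3)$. -/

import Mathlib

namespace BigradedSyzygy

open MvPolynomial

/-- The polynomial ring `R = k[x, y, z, w]`; the variables `x, y, z, w` are `X 0, X 1, X 2, X 3`. -/
abbrev BiRing (k : Type*) [Field k] : Type _ := MvPolynomial (Fin 4) k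

/-- The bidegrees of the variables: `x, y` have degree `(1, 0)` and `z, w` have degree `(0, 1)`. -/
def varBidegree : Fin 4 → ℕ × ℕ := ![(1, 0), (1, 0), (0, 1), (0, 1)]

/-- The graded piece `R_{m,n}` of `R`, a `k`-subspace. -/
noncomputable def gradedPiece (k : Type*) [Field k] (m n : ℕ) : Submodule k (BiRing k) :=
  weightedHomogeneousSubmodule k varBidegree (m, n)

/-- The polynomials `p₀, p₁, p₂` have no common zero on `ℙ¹ × ℙ¹`: there is no pair of nonzero
vectors `(x, y)`, `(z, w)` of homogeneous coordinates at which all three vanish. -/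
def NoCommonZeros {k : Type*} [Field k] (p : Fin 3 → BiRing k) : Prop :=
  ∀ x y z w : k, ¬ (x = 0 ∧ y = 0) → ¬ (z = 0 ∧ w = 0) →
    ∃ i, eval ![x, y, z, w] (p i) ≠ 0

/-- The syzygy module `Syz(p)`: the triples `(A₀, A₁, A₂)` with `A₀ p₀ + A₁ p₁ + A₂ p₂ = 0`. -/
noncomputable def Syz {k : Type*} [Field k] (p : Fin 3 → BiRing k) :
    Submodule (BiRing k) (Fin 3 → BiRing k) :=
  LinearMap.ker (Fintype.linearCombination (BiRing k) p)

/-- `A` is an element of bidegree `d` of the shifted free module `R(-2, -1)³`: every monomial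
occurring in a component of `A` has bidegree `d - (2, 1)`. As `Syz(p)` is a graded submodule of
`R(-2, -1)³`, this is also the bidegree of a syzygy. -/
def HasBidegree {k : Type*} [Field k] (A : Fin 3 → BiRing k) (d : ℕ × ℕ) : Prop :=
  ∀ (i : Fin 3) (s : Fin 4 →₀ ℕ), coeff s (A i) ≠ 0 →
    Finsupp.weight varBidegree s + (2, 1) = d

/-- `S` is a minimal set of bihomogeneous generators of `Syz(p)`: a set of bihomogeneous elements
generating `Syz(p)` as an `R`-module and minimal (for inclusion) with this property. -/
def IsMinimalGeneratingSet {k : Type*} [Field k] (p : Fin 3 → BiRing k)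
    (S : Set (Fin 3 → BiRing k)) : Prop :=
  Minimal (fun T : Set (Fin 3 → BiRing k) =>
    (∀ A ∈ T, ∃ d, HasBidegree A d) ∧ Submodule.span (BiRing k) T = Syz p) S

/-- `W(p) = ℙ(Span(p₀, p₁, p₂))`, as a subset of `ℙ(R_{2,1}) ≃ ℙ⁵`. -/
def planeW {k : Type*} [Field k] (p : Fin 3 → BiRing k) :
    Set (Projectivization k (gradedPiece k 2 1)) :=
  {v | (v.rep : BiRing k) ∈ Submodule.span k (Set.range p)}

/-- `Y ⊂ ℙ(R_{2,1})`, the image of the Segre embedding `ℙ(R_{2,0}) × ℙ(R_{0,1}) → ℙ(R_{2,1})`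
given by multiplication. -/
def segreY (k : Type*) [Field k] : Set (Projectivization k (gradedPiece k 2 1)) :=
  {v | ∃ q ∈ gradedPiece k 2 0, ∃ l ∈ gradedPiece k 0 1, (v.rep : BiRing k) = q * l}

/-- `p₀, p₁, p₂` are generic if `W(p) ∩ Y` is finite. -/
def IsGeneric {k : Type*} [Field k] (p : Fin 3 → BiRing k) : Prop :=
  (planeW p ∩ segreY k).Finite

end BigradedSyzygy

/-!
The proof is elementary. Write `p = x² a + xy b + y² c` with vectors `a, b, c` of linear forms
`z F_j + w G_j`, and also `p = z f + w g` with vectors `f, g` of quadratic forms in `x, y`. The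
absence of common zeros says that, at each point `(z : w)`, the quadratic form in `x, y` with
coefficient vectors `a, b, c` has no zero (`IsBasePointFree`).

* Syzygies of degree `1` in `z, w` are orthogonal to `f` and `g`, so they are multiples of `f × g`,
  of degree `(6, 1)` (`exists_eq_smul_quadForm_cross`).
* Modulo `x`, a syzygy of degree at least `4` in `x, y` and at least `2` in `z, w` is a power of `y`
  times a syzygy of `c`, which is a Koszul one. Subtracting a multiple of a Koszul syzygy `p × e_i`,
  of degree `(4, 2)`, and dividing by `x` lowers the degree in `x, y` down to `3`
  (`mem_of_koszul_of_cubic`).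
* Let `det` be the determinant of `(a, b, c)`. If `det ≠ 0`, there are no syzygies of degree `2`
  in `x, y`, and those of degree `3` are generated by `x (a × b) + y (a × c)` and
  `x (a × c) + y (b × c)`, of degree `(3, 3)`: Cramer's rule gives this up to the factor `det`, which
  can be cancelled as the two vectors are independent at each point (`mem_span_cubicSyzygy`).
* If `det = 0`, then `a, b, c` satisfy a relation `N₀ a + N₁ b + N₂ c = 0` with constant coefficients
  and `N₀ N₂ ≠ N₁²`: for a relation of positive degree, the form `N₀ N₂ - N₁²` has a zero, which is a
  common zero of `p` or a common zero of the `N_i` (`exists_const_relation`). Then the minors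
  `a × b, a × c, b × c` are constant multiples of one vector `D` of degree `(2, 3)`, which generates
  the syzygies of degrees `2` and `3` in `x, y`.

In the bidegrees of these generators there are no syzygies of smaller bidegree, so that the minimal
generators of such a bidegree form a basis of the space of syzygies; there are none in other
bidegrees (`minimalGeneratingSets_of_three_bidegrees`). Finally, the points of `W(p) ∩ Y` lie over
the roots of `det`, one over each root, so `p` is generic exactly if `det ≠ 0`.

The cancellation of `det`, and the divisibility by the minors in the other cases, all rest on
`IsBinaryForm.dvd_of_mul_eq_sum`: vectors that are independent at every point of `ℙ¹` generate a
module that is saturated with respect to binary forms.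
-/

namespace BigradedSyzygy

open MvPolynomial Matrix

variable {k : Type*} [Field k]

/-! ### Bigraded pieces of the polynomial ring -/

lemma weight_varBidegree (s : Fin 4 →₀ ℕ) :
    Finsupp.weight varBidegree s = (s 0 + s 1, s 2 + s 3) := by
  rw [Finsupp.weight_apply, Finsupp.sum_fintype _ _ (by simp)]
  simp [Fin.sum_univ_four, varBidegree, Prod.ext_iff]

lemma mem_gradedPiece {m n : ℕ} {r : BiRing k} :
    r ∈ gradedPiece k m n ↔ IsWeightedHomogeneous varBidegree r (m, n) := Iff.rfl

lemma mul_mem_gradedPiece {m n m' n' : ℕ} {r s : BiRing k} (hr : r ∈ gradedPiece k m n)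
    (hs : s ∈ gradedPiece k m' n') : r * s ∈ gradedPiece k (m + m') (n + n') :=
  IsWeightedHomogeneous.mul hr hs

lemma X_mem_gradedPiece (i : Fin 4) :
    (X i : BiRing k) ∈ gradedPiece k (varBidegree i).1 (varBidegree i).2 :=
  isWeightedHomogeneous_X _ _ _

lemma C_mem_gradedPiece (c : k) : (C c : BiRing k) ∈ gradedPiece k 0 0 :=
  isWeightedHomogeneous_C _ _

lemma C_mul_mem_gradedPiece {m n : ℕ} {r : BiRing k} (c : k) (hr : r ∈ gradedPiece k m n) :
    C c * r ∈ gradedPiece k m n := by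
  rw [C_mul']; exact Submodule.smul_mem _ _ hr

lemma X_pow_mem_gradedPiece (i : Fin 4) (e : ℕ) :
    (X i ^ e : BiRing k) ∈ gradedPiece k (e * (varBidegree i).1) (e * (varBidegree i).2) := by
  have := (isWeightedHomogeneous_X k varBidegree i).pow e
  rw [mem_gradedPiece]
  convert this using 1
  simp [Prod.ext_iff]

lemma monomial_mem_gradedPiece {m n : ℕ} {s : Fin 4 →₀ ℕ} (c : k) (h1 : s 0 + s 1 = m)
    (h2 : s 2 + s 3 = n) : monomial s c ∈ gradedPiece k m n :=
  isWeightedHomogeneous_monomial _ _ _ (by rw [weight_varBidegree, h1, h2])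

/-- A graded piece is spanned by its monomials, so a linear condition may be checked on these. -/
lemma gradedPiece_induction {m n : ℕ} (P : Submodule k (BiRing k))
    (hP : ∀ s : Fin 4 →₀ ℕ, s 0 + s 1 = m → s 2 + s 3 = n → monomial s (1 : k) ∈ P) :
    gradedPiece k m n ≤ P := by
  intro r hr
  rw [r.as_sum]
  refine Submodule.sum_mem _ fun s hs => ?_
  have h := hr (mem_support_iff.1 hs)
  rw [weight_varBidegree, Prod.mk.injEq] at h
  have := P.smul_mem (coeff s r) (hP s h.1 h.2)
  rwa [smul_monomial, smul_eq_mul, mul_one] at this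

lemma eval_smul_of_mem {m n : ℕ} {r : BiRing k} (hr : r ∈ gradedPiece k m n) (s t : k)
    (v : Fin 4 → k) :
    eval ![s * v 0, s * v 1, t * v 2, t * v 3] r = s ^ m * t ^ n * eval v r := by
  let P : Submodule k (BiRing k) :=
    { carrier := {r | eval ![s * v 0, s * v 1, t * v 2, t * v 3] r = s ^ m * t ^ n * eval v r}
      add_mem' := by
        intro a b ha hb
        simp only [Set.mem_ofPred_eq, map_add] at *
        rw [ha, hb]; ring
      zero_mem' := by simp
      smul_mem' := by
        intro c a ha
        simp only [Set.mem_ofPred_eq, smul_eval] at *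
        rw [ha]; ring }
  refine (gradedPiece_induction P ?_) hr
  intro e h1 h2
  change eval _ _ = _
  rw [eval_monomial, eval_monomial, Finsupp.prod_fintype _ _ (by simp),
    Finsupp.prod_fintype _ _ (by simp)]
  simp [Fin.prod_univ_four, ← h1, ← h2]
  ring

/-- A form of degree `(0, n)` depends on `z, w` only. -/
lemma eval_of_mem_zero_left {n : ℕ} {r : BiRing k} (hr : r ∈ gradedPiece k 0 n)
    (v v' : Fin 4 → k) (h2 : v 2 = v' 2) (h3 : v 3 = v' 3) : eval v r = eval v' r := by
  have a := eval_smul_of_mem hr 0 1 v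
  have b := eval_smul_of_mem hr 0 1 v'
  simp only [zero_mul, one_mul, pow_zero, one_pow] at a b
  rw [← a, ← b, h2, h3]

/-- A form of degree `(m, 0)` depends on `x, y` only. -/
lemma eval_of_mem_zero_right {m : ℕ} {r : BiRing k} (hr : r ∈ gradedPiece k m 0)
    (v v' : Fin 4 → k) (h0 : v 0 = v' 0) (h1 : v 1 = v' 1) : eval v r = eval v' r := by
  have a := eval_smul_of_mem hr 1 0 v
  have b := eval_smul_of_mem hr 1 0 v'
  simp only [zero_mul, one_mul, pow_zero, one_pow] at a b
  rw [← a, ← b, h0, h1]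

lemma exists_eq_C_of_mem {r : BiRing k} (hr : r ∈ gradedPiece k 0 0) : ∃ c : k, r = C c := by
  suffices h : gradedPiece k 0 0 ≤ LinearMap.range (Algebra.linearMap k (BiRing k)) by
    obtain ⟨c, hc⟩ := h hr
    exact ⟨c, hc.symm⟩
  refine gradedPiece_induction _ fun s h1 h2 => ⟨1, ?_⟩
  have : s = 0 := by
    ext i; fin_cases i <;> simp <;> omega
  simp [this]

/-- Separate the monomials of a form that are divisible by `x`; what remains is a multiple of a
power of `y`. -/
lemma exists_eq_X_zero_mul_add {m n : ℕ} {r : BiRing k} (hr : r ∈ gradedPiece k (m + 1) n) :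
    ∃ r' ∈ gradedPiece k m n, ∃ t ∈ gradedPiece k 0 n, r = X 0 * r' + X 1 ^ (m + 1) * t := by
  suffices h : gradedPiece k (m + 1) n ≤
      (gradedPiece k m n).map (LinearMap.mulLeft k (X 0)) ⊔
        (gradedPiece k 0 n).map (LinearMap.mulLeft k (X 1 ^ (m + 1))) by
    obtain ⟨_, ⟨r', hr', rfl⟩, _, ⟨t, ht, rfl⟩, e⟩ := Submodule.mem_sup.1 (h hr)
    exact ⟨r', hr', t, ht, e.symm⟩
  refine gradedPiece_induction _ fun s h1 h2 => ?_
  by_cases h0 : s 0 = 0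
  · refine Submodule.mem_sup_right ⟨monomial (s - Finsupp.single 1 (m + 1)) 1, ?_, ?_⟩
    · refine monomial_mem_gradedPiece _ ?_ ?_ <;> simp <;> omega
    · rw [LinearMap.mulLeft_apply, X_pow_eq_monomial, monomial_mul, one_mul,
        add_tsub_cancel_of_le]
      rw [Finsupp.single_le_iff]; omega
  · refine Submodule.mem_sup_left ⟨monomial (s - Finsupp.single 0 1) 1, ?_, ?_⟩
    · refine monomial_mem_gradedPiece _ ?_ ?_ <;> simp <;> omega
    · rw [LinearMap.mulLeft_apply, X, monomial_mul, one_mul, add_tsub_cancel_of_le]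
      rw [Finsupp.single_le_iff]; omega

lemma exists_eq_X_two_mul_add {m n : ℕ} {r : BiRing k} (hr : r ∈ gradedPiece k m (n + 1)) :
    ∃ r' ∈ gradedPiece k m n, ∃ t ∈ gradedPiece k m 0, r = X 2 * r' + X 3 ^ (n + 1) * t := by
  suffices h : gradedPiece k m (n + 1) ≤
      (gradedPiece k m n).map (LinearMap.mulLeft k (X 2)) ⊔
        (gradedPiece k m 0).map (LinearMap.mulLeft k (X 3 ^ (n + 1))) by
    obtain ⟨_, ⟨r', hr', rfl⟩, _, ⟨t, ht, rfl⟩, e⟩ := Submodule.mem_sup.1 (h hr)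
    exact ⟨r', hr', t, ht, e.symm⟩
  refine gradedPiece_induction _ fun s h1 h2 => ?_
  by_cases h0 : s 2 = 0
  · refine Submodule.mem_sup_right ⟨monomial (s - Finsupp.single 3 (n + 1)) 1, ?_, ?_⟩
    · refine monomial_mem_gradedPiece _ ?_ ?_ <;> simp <;> omega
    · rw [LinearMap.mulLeft_apply, X_pow_eq_monomial, monomial_mul, one_mul,
        add_tsub_cancel_of_le]
      rw [Finsupp.single_le_iff]; omega
  · refine Submodule.mem_sup_left ⟨monomial (s - Finsupp.single 2 1) 1, ?_, ?_⟩
    · refine monomial_mem_gradedPiece _ ?_ ?_ <;> simp <;> omega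
    · rw [LinearMap.mulLeft_apply, X, monomial_mul, one_mul, add_tsub_cancel_of_le]
      rw [Finsupp.single_le_iff]; omega

/-- The component of bidegree `u + e` of a product whose second factor has bidegree `e`. -/
lemma weightedHomogeneousComponent_mul_right {e : ℕ × ℕ} {q : BiRing k}
    (hq : IsWeightedHomogeneous varBidegree q e) (u : ℕ × ℕ) (r : BiRing k) :
    weightedHomogeneousComponent varBidegree (u + e) (r * q) =
      weightedHomogeneousComponent varBidegree u r * q := by
  induction r using MvPolynomial.induction_on' with
  | monomial s a =>
    have h := isWeightedHomogeneous_monomial varBidegree s a rfl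
    rw [weightedHomogeneousComponent_of_mem h, weightedHomogeneousComponent_of_mem (h.mul hq)]
    simp only [add_left_inj]
    split_ifs <;> simp
  | add f g hf hg => rw [add_mul, map_add, map_add, hf, hg, add_mul]

lemma weightedHomogeneousComponent_mul_eq_zero {e d : ℕ × ℕ} {q : BiRing k}
    (hq : IsWeightedHomogeneous varBidegree q e) (hd : ¬ e ≤ d) (r : BiRing k) :
    weightedHomogeneousComponent varBidegree d (r * q) = 0 := by
  induction r using MvPolynomial.induction_on' with
  | monomial s a =>
    have h := isWeightedHomogeneous_monomial varBidegree s a rfl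
    rw [weightedHomogeneousComponent_of_mem (h.mul hq), if_neg]
    rintro rfl
    exact hd le_add_self
  | add f g hf hg => rw [add_mul, map_add, hf, hg, add_zero]

/-! ### Bihomogeneous elements of the shifted free module -/

lemma hasBidegree_add_iff {A : Fin 3 → BiRing k} {m n : ℕ} :
    HasBidegree A (m + 2, n + 1) ↔ ∀ i, A i ∈ gradedPiece k m n := by
  have h : ∀ e : ℕ × ℕ, e + (2, 1) = (m + 2, n + 1) ↔ e = (m, n) := by
    intro e
    rw [show (m + 2, n + 1) = (m, n) + (2, 1) from rfl, add_left_inj]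
  simp only [HasBidegree, h]
  rfl

lemma hasBidegree_zero (d : ℕ × ℕ) : HasBidegree (0 : Fin 3 → BiRing k) d := by
  intro i s h
  simp at h

lemma HasBidegree.eq_zero_or {A : Fin 3 → BiRing k} {d : ℕ × ℕ} (hA : HasBidegree A d) :
    A = 0 ∨ ∃ m n, d = (m + 2, n + 1) := by
  refine or_iff_not_imp_left.2 fun h => ?_
  obtain ⟨i, hi⟩ := Function.ne_iff.1 h
  obtain ⟨s, hs⟩ := ne_zero_iff.1 hi
  have := hA i s hs
  rw [weight_varBidegree] at this
  exact ⟨_, _, this.symm⟩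

lemma HasBidegree.unique {A : Fin 3 → BiRing k} {d e : ℕ × ℕ} (hA : HasBidegree A d)
    (hA' : HasBidegree A e) (h : A ≠ 0) : d = e := by
  obtain ⟨i, hi⟩ := Function.ne_iff.1 h
  obtain ⟨s, hs⟩ := ne_zero_iff.1 hi
  rw [← hA i s hs, ← hA' i s hs]

/-- The elements of `R(-2, -1)³` of a given bidegree, as a `k`-subspace. -/
def bidegreeSubmodule (k : Type*) [Field k] (d : ℕ × ℕ) : Submodule k (Fin 3 → BiRing k) where
  carrier := {A | HasBidegree A d}
  add_mem' := by
    intro A B hA hB i s hs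
    by_cases h : coeff s (A i) = 0
    · refine hB i s fun h' => hs ?_
      rw [Pi.add_apply, coeff_add, h, h', add_zero]
    · exact hA i s h
  zero_mem' := hasBidegree_zero d
  smul_mem' := by
    intro c A hA i s hs
    refine hA i s fun h => hs ?_
    rw [Pi.smul_apply, coeff_smul, h, smul_zero]

/-- A bihomogeneous element of the `R`-span of bihomogeneous elements is a combination of these
with coefficients of the expected bidegrees. -/
lemma mem_span_of_hasBidegree {S : Set (Fin 3 → BiRing k)} {A : Fin 3 → BiRing k} {d : ℕ × ℕ}
    (hS : ∀ s ∈ S, ∃ e, HasBidegree s e) (hA : A ∈ Submodule.span (BiRing k) S)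
    (hd : HasBidegree A d) :
    A ∈ Submodule.span k {B | ∃ s ∈ S, ∃ e u, HasBidegree s e ∧ u + e = d ∧
      ∃ r ∈ gradedPiece k u.1 u.2, B = r • s} := by
  obtain rfl | ⟨m, n, rfl⟩ := hd.eq_zero_or
  · exact zero_mem _
  set N := Submodule.span k {B | ∃ s ∈ S, ∃ e u, HasBidegree s e ∧ u + e = (m + 2, n + 1) ∧
      ∃ r ∈ gradedPiece k u.1 u.2, B = r • s} with hN
  let π : (Fin 3 → BiRing k) →ₗ[k] (Fin 3 → BiRing k) :=
    LinearMap.pi fun i => (weightedHomogeneousComponent varBidegree (m, n)).comp (LinearMap.proj i)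
  have hπ : ∀ B i, π B i = weightedHomogeneousComponent varBidegree (m, n) (B i) := fun B i => rfl
  have hπA : π A = A := by
    funext i
    rw [hπ]
    exact weightedHomogeneousComponent_eq_self (hasBidegree_add_iff.1 hd i)
  suffices h : ∀ r : BiRing k, π (r • A) ∈ N by
    have := h 1
    rwa [one_smul, hπA] at this
  clear hπA hd
  induction hA using Submodule.span_induction with
  | mem s hs =>
    intro r
    obtain ⟨e, he⟩ := hS s hs
    obtain rfl | ⟨m', n', rfl⟩ := he.eq_zero_or
    · simp
    have he' := hasBidegree_add_iff.1 he
    by_cases hle : (m', n') ≤ (m, n)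
    · obtain ⟨u, hu⟩ := exists_add_of_le hle
      rw [add_comm] at hu
      refine Submodule.subset_span ⟨s, hs, _, u, he, ?_, _,
        weightedHomogeneousComponent_isWeightedHomogeneous u r, ?_⟩
      · rw [show (m + 2, n + 1) = (m, n) + (2, 1) from rfl, hu, add_assoc]
        rfl
      · funext i
        rw [hπ, Pi.smul_apply, Pi.smul_apply, smul_eq_mul, smul_eq_mul, hu]
        exact weightedHomogeneousComponent_mul_right (he' i) u r
    · convert N.zero_mem
      funext i
      rw [hπ, Pi.smul_apply, smul_eq_mul]
      exact weightedHomogeneousComponent_mul_eq_zero (he' i) hle r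
  | zero => simp
  | add A B _ _ hA hB =>
    intro r
    rw [smul_add, map_add]
    exact add_mem (hA r) (hB r)
  | smul a A _ hA =>
    intro r
    rw [smul_smul]
    exact hA _

lemma mem_span_of_le {S : Set (Fin 3 → BiRing k)} {A : Fin 3 → BiRing k} {d : ℕ × ℕ}
    (hS : ∀ s ∈ S, ∃ e, HasBidegree s e) (hA : A ∈ Submodule.span (BiRing k) S)
    (hd : HasBidegree A d) :
    A ∈ Submodule.span (BiRing k) {s | s ∈ S ∧ ∃ e ≤ d, HasBidegree s e} := by
  have h := mem_span_of_hasBidegree hS hA hd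
  refine (Submodule.span_le (p := (Submodule.span (BiRing k)
    {s | s ∈ S ∧ ∃ e ≤ d, HasBidegree s e}).restrictScalars k)).2 ?_ h
  rintro _ ⟨s, hs, e, u, he, rfl, r, -, rfl⟩
  have hmem : s ∈ {s | s ∈ S ∧ ∃ e' ≤ u + e, HasBidegree s e'} := ⟨hs, e, le_add_self, he⟩
  exact Submodule.smul_mem _ r (Submodule.subset_span hmem)

/-- If the spanning set has no nonzero elements of smaller bidegree, then scalar coefficients
suffice. -/
lemma mem_span_field_of_minimal {S : Set (Fin 3 → BiRing k)} {A : Fin 3 → BiRing k} {d : ℕ × ℕ}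
    (hS : ∀ s ∈ S, ∃ e, HasBidegree s e) (hA : A ∈ Submodule.span (BiRing k) S)
    (hd : HasBidegree A d) (hlow : ∀ s ∈ S, ∀ e ≤ d, e ≠ d → HasBidegree s e → s = 0) :
    A ∈ Submodule.span k {s | s ∈ S ∧ HasBidegree s d} := by
  have h := mem_span_of_hasBidegree hS hA hd
  refine Submodule.span_le.2 ?_ h
  rintro _ ⟨s, hs, e, u, he, rfl, r, hr, rfl⟩
  by_cases hu : u = 0
  · subst hu
    obtain ⟨c, rfl⟩ := exists_eq_C_of_mem hr
    rw [zero_add, ← algebraMap_eq, algebraMap_smul]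
    exact Submodule.smul_mem _ _ (Submodule.subset_span ⟨hs, he⟩)
  · rw [hlow s hs e le_add_self (by simpa using hu) he, smul_zero]
    exact zero_mem _

lemma eq_zero_of_mem_span {S : Set (Fin 3 → BiRing k)} {A : Fin 3 → BiRing k} {d : ℕ × ℕ}
    (hS : ∀ s ∈ S, ∃ e, ¬ e ≤ d ∧ HasBidegree s e) (hA : A ∈ Submodule.span (BiRing k) S)
    (hd : HasBidegree A d) : A = 0 := by
  have hS' : ∀ s ∈ S, ∃ e, HasBidegree s e := fun s hs =>
    let ⟨e, he⟩ := hS s hs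
    ⟨e, he.2⟩
  have h := mem_span_of_le hS' hA hd
  rw [← Submodule.mem_bot (BiRing k)]
  refine Submodule.span_le.2 ?_ h
  rintro s ⟨hs, e, he, hse⟩
  obtain ⟨e', he', hse'⟩ := hS s hs
  by_contra h0
  exact he' (hse'.unique hse h0 ▸ he)

/-! ### Minimal generating sets -/

section Minimal

variable {p : Fin 3 → BiRing k} {S T : Set (Fin 3 → BiRing k)}

lemma IsMinimalGeneratingSet.notMem_span_diff (hS : IsMinimalGeneratingSet p S)
    {s : Fin 3 → BiRing k} (hs : s ∈ S) : s ∉ Submodule.span (BiRing k) (S \ {s}) := by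
  intro h
  have hspan : Submodule.span (BiRing k) (S \ {s}) = Syz p := by
    rw [← hS.1.2]
    refine le_antisymm (Submodule.span_mono Set.sdiff_subset) (Submodule.span_le.2 fun t ht => ?_)
    by_cases hts : t = s
    · rwa [hts]
    · exact Submodule.subset_span ⟨ht, hts⟩
  exact (hS.2 ⟨fun A hA => hS.1.1 A hA.1, hspan⟩ Set.sdiff_subset hs).2 rfl

lemma IsMinimalGeneratingSet.ne_zero (hS : IsMinimalGeneratingSet p S)
    {s : Fin 3 → BiRing k} (hs : s ∈ S) : s ≠ 0 := by
  rintro rfl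
  exact hS.notMem_span_diff hs (zero_mem _)

/-- The bidegree of a minimal generator occurs in every bihomogeneous generating set: otherwise
the generator would be a combination of elements of strictly smaller bidegree, hence of other
minimal generators. -/
lemma IsMinimalGeneratingSet.exists_hasBidegree (hS : IsMinimalGeneratingSet p S)
    (hT : ∀ t ∈ T, ∃ e, HasBidegree t e) (hspan : Submodule.span (BiRing k) T = Syz p)
    {s : Fin 3 → BiRing k} (hs : s ∈ S) {d : ℕ × ℕ} (hd : HasBidegree s d) :
    ∃ t ∈ T, HasBidegree t d := by
  by_contra! hno
  have hsT : s ∈ Submodule.span (BiRing k) T := by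
    rw [hspan, ← hS.1.2]; exact Submodule.subset_span hs
  refine hS.notMem_span_diff hs (Submodule.span_le.2 ?_ (mem_span_of_le hT hsT hd))
  rintro t ⟨ht, e, hed, hte⟩
  have hne : e ≠ d := by
    rintro rfl
    exact hno t ht hte
  have htS : t ∈ Submodule.span (BiRing k) S := by
    rw [hS.1.2, ← hspan]; exact Submodule.subset_span ht
  refine Submodule.span_mono ?_ (mem_span_of_le hS.1.1 htS hte)
  rintro s' ⟨hs', e', he', hse'⟩
  refine ⟨hs', ?_⟩
  rintro rfl
  have := hse'.unique hd (hS.ne_zero hs')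
  exact hne (le_antisymm hed (this ▸ he'))

/-- In a bidegree below which there are no syzygies, the minimal generators form a `k`-basis of
the space of syzygies, so they are as many as the elements of any such basis. -/
lemma IsMinimalGeneratingSet.encard_eq (hS : IsMinimalGeneratingSet p S)
    (hT : ∀ t ∈ T, ∃ e, HasBidegree t e) (hspan : Submodule.span (BiRing k) T = Syz p)
    {d : ℕ × ℕ} (hlow : ∀ A ∈ Syz p, ∀ e ≤ d, e ≠ d → HasBidegree A e → A = 0)
    (hind : LinearIndepOn k id {t | t ∈ T ∧ HasBidegree t d}) :
    {s ∈ S | HasBidegree s d}.encard = {t | t ∈ T ∧ HasBidegree t d}.encard := by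
  have key : ∀ U : Set (Fin 3 → BiRing k), (∀ t ∈ U, ∃ e, HasBidegree t e) →
      Submodule.span (BiRing k) U = Syz p →
      Submodule.span k {t | t ∈ U ∧ HasBidegree t d} =
        (Syz p).restrictScalars k ⊓ bidegreeSubmodule k d := by
    intro U hU hspanU
    refine le_antisymm (Submodule.span_le.2 fun t ht => ⟨?_, ht.2⟩) fun A hA => ?_
    · change t ∈ Syz p
      rw [← hspanU]
      exact Submodule.subset_span ht.1
    · have h1 : A ∈ Syz p := hA.1
      rw [← hspanU] at h1
      refine mem_span_field_of_minimal hU h1 hA.2 fun s hs e he hne hse => ?_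
      exact hlow s (hspanU ▸ Submodule.subset_span hs) e he hne hse
  have hindS : LinearIndepOn k id {s | s ∈ S ∧ HasBidegree s d} := by
    rw [LinearIndepOn, linearIndependent_iff_notMem_span]
    rintro ⟨s, hs⟩ hmem
    refine hS.notMem_span_diff hs.1 ?_
    refine Submodule.span_le_restrictScalars k (BiRing k) _ (Submodule.span_mono ?_ hmem)
    rintro _ ⟨⟨t, ht⟩, ⟨-, hts⟩, rfl⟩
    exact ⟨ht.1, fun h => hts (Subtype.ext h)⟩
  have h1 := toENat_rank_span_set hindS
  have h2 := toENat_rank_span_set hind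
  rw [Set.image_id] at h1 h2
  rw [key S hS.1.1 hS.1.2] at h1
  rw [key T hT hspan, h1] at h2
  exact h2

lemma exists_isMinimalGeneratingSet (hfin : T.Finite)
    (hT : ∀ t ∈ T, ∃ e, HasBidegree t e) (hspan : Submodule.span (BiRing k) T = Syz p) :
    ∃ S, IsMinimalGeneratingSet p S := by
  let 𝒰 : Set (Set (Fin 3 → BiRing k)) := {U | U ⊆ T ∧
    (∀ A ∈ U, ∃ d, HasBidegree A d) ∧ Submodule.span (BiRing k) U = Syz p}
  have hfin' : 𝒰.Finite := hfin.finite_subsets.subset fun U hU => hU.1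
  obtain ⟨S, hS⟩ := hfin'.exists_minimal ⟨T, subset_rfl, hT, hspan⟩
  exact ⟨S, hS.1.2, fun U hU hle => hS.2 ⟨hle.trans hS.1.1, hU⟩ hle⟩

/-- The Betti numbers of `Syz(p)` are read off from a generating set that consists of
`k`-independent elements in three distinct bidegrees, each with no syzygies below it. -/
theorem minimalGeneratingSets_of_three_bidegrees {d : Fin 3 → ℕ × ℕ} (hd : Function.Injective d)
    {U : Fin 3 → Set (Fin 3 → BiRing k)} (hfin : ∀ j, (U j).Finite)
    (hU : ∀ j, ∀ t ∈ U j, HasBidegree t (d j))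
    (hspan : Submodule.span (BiRing k) (⋃ j, U j) = Syz p)
    (hind : ∀ j, LinearIndepOn k id (U j))
    (hlow : ∀ j, ∀ A ∈ Syz p, ∀ e ≤ d j, e ≠ d j → HasBidegree A e → A = 0) :
    (∃ S, IsMinimalGeneratingSet p S) ∧ ∀ S, IsMinimalGeneratingSet p S →
      S.encard = (U 0).encard + (U 1).encard + (U 2).encard ∧
      ∀ j, {s ∈ S | HasBidegree s (d j)}.encard = (U j).encard := by
  have hT : ∀ t ∈ ⋃ j, U j, ∃ e, HasBidegree t e := by
    intro t ht
    obtain ⟨j, hj⟩ := Set.mem_iUnion.1 ht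
    exact ⟨_, hU j t hj⟩
  have hUd : ∀ j, {t | t ∈ ⋃ j, U j ∧ HasBidegree t (d j)} = U j := by
    intro j
    ext t
    refine ⟨fun ht => ?_, fun ht => ⟨Set.mem_iUnion.2 ⟨j, ht⟩, hU j t ht⟩⟩
    obtain ⟨i, hi⟩ := Set.mem_iUnion.1 ht.1
    have hne : t ≠ 0 := (hind i).ne_zero hi
    rwa [← hd ((hU i t hi).unique ht.2 hne)]
  refine ⟨exists_isMinimalGeneratingSet (Set.finite_iUnion hfin) hT hspan, fun S hS => ?_⟩
  have hcard : ∀ j, {s ∈ S | HasBidegree s (d j)}.encard = (U j).encard := by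
    intro j
    rw [hS.encard_eq hT hspan (hlow j) (by rw [hUd]; exact hind j), hUd]
  refine ⟨?_, hcard⟩
  have hdisj : ∀ i j, i ≠ j →
      Disjoint {s ∈ S | HasBidegree s (d i)} {s ∈ S | HasBidegree s (d j)} := by
    intro i j hij
    rw [Set.disjoint_left]
    rintro s ⟨hs, h1⟩ ⟨-, h2⟩
    exact hij (hd (h1.unique h2 (hS.ne_zero hs)))
  have hunion : S = ({s ∈ S | HasBidegree s (d 0)} ∪ {s ∈ S | HasBidegree s (d 1)}) ∪
      {s ∈ S | HasBidegree s (d 2)} := by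
    ext s
    refine ⟨fun hs => ?_, by rintro ((h | h) | h) <;> exact h.1⟩
    obtain ⟨e, he⟩ := hS.1.1 s hs
    obtain ⟨t, ht, hte⟩ := hS.exists_hasBidegree hT hspan hs he
    obtain ⟨j, hj⟩ := Set.mem_iUnion.1 ht
    have := (hU j t hj).unique hte ((hind j).ne_zero hj)
    subst this
    fin_cases j
    · exact Or.inl (Or.inl ⟨hs, he⟩)
    · exact Or.inl (Or.inr ⟨hs, he⟩)
    · exact Or.inr ⟨hs, he⟩
  conv_lhs => rw [hunion]
  rw [Set.encard_union_eq, Set.encard_union_eq (hdisj 0 1 (by decide)), hcard, hcard, hcard]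
  rw [Set.disjoint_union_left]
  exact ⟨hdisj 0 2 (by decide), hdisj 1 2 (by decide)⟩

end Minimal

/-! ### Division by binary forms -/

/-- The linear form in `X i, X j` that vanishes at the point `(s : t)`. -/
noncomputable def linForm (i j : Fin 4) (q : k × k) : BiRing k := C q.2 * X i - C q.1 * X j

lemma eval_linForm (i j : Fin 4) (q : k × k) (v : Fin 4 → k) :
    eval v (linForm i j q) = q.2 * v i - q.1 * v j := by
  simp [linForm]

lemma linForm_swap (i j : Fin 4) (q : k × k) : linForm i j q = -linForm j i q.swap := by
  simp [linForm]

lemma linForm_ne_zero {i j : Fin 4} (hij : i ≠ j) {q : k × k} (hq : ¬ (q.1 = 0 ∧ q.2 = 0)) :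
    linForm i j q ≠ 0 := by
  intro h
  have h1 := eval_linForm i j q (Pi.single i 1)
  have h2 := eval_linForm i j q (Pi.single j 1)
  rw [h] at h1 h2
  simp [hij, hij.symm] at h1 h2
  exact hq ⟨h2, h1.symm⟩

lemma eval_aeval_eq (v : Fin 4 → k) (g : Fin 4 → BiRing k) (r : BiRing k) :
    eval v (aeval g r) = eval (fun l => eval v (g l)) r := by
  induction r using MvPolynomial.induction_on with
  | C a => simp [algebraMap_eq]
  | add p q hp hq => rw [map_add, map_add, hp, hq, map_add]
  | mul_X p l hp => rw [map_mul, map_mul, hp, aeval_X, map_mul, eval_X]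

lemma polynomial_eval_aeval_eq (t : k) (g : Fin 4 → Polynomial k) (r : BiRing k) :
    (aeval g r : Polynomial k).eval t = eval (fun l => (g l).eval t) r := by
  induction r using MvPolynomial.induction_on with
  | C a => simp
  | add p q hp hq => simp [hp, hq]
  | mul_X p l hp => simp [hp]

/-- Polynomials over an infinite field that agree where a given coordinate is nonzero are equal. -/
lemma eq_of_eval_eq_of_ne_zero [Infinite k] (j : Fin 4) {r s : BiRing k}
    (h : ∀ v : Fin 4 → k, v j ≠ 0 → eval v r = eval v s) : r = s := by
  have : X j * r = X j * s := by
    refine MvPolynomial.funext fun v => ?_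
    rw [map_mul, map_mul, eval_X]
    by_cases hv : v j = 0
    · rw [hv, zero_mul, zero_mul]
    · rw [h v hv]
  exact mul_left_cancel₀ (X_ne_zero j) this

lemma linForm_dvd_of_snd_ne_zero [Infinite k] {i j : Fin 4} (hij : i ≠ j) {q : k × k}
    (hq : q.2 ≠ 0) {r : BiRing k}
    (h : ∀ v : Fin 4 → k, q.2 * v i = q.1 * v j → v j ≠ 0 → eval v r = 0) :
    linForm i j q ∣ r := by
  -- Substituting `X i = (s / t) X j` kills `r` and changes it by a multiple of the linear form.
  let φ : BiRing k →ₐ[k] BiRing k := aeval (Function.update X i (C (q.1 / q.2) * X j))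
  have hφ : φ r = 0 := by
    refine eq_of_eval_eq_of_ne_zero j fun v hv => ?_
    have : eval v (φ r) = eval (Function.update v i (q.1 / q.2 * v j)) r := by
      rw [eval_aeval_eq]
      congr 2
      funext l
      by_cases hl : l = i
      · subst hl; simp
      · simp [hl]
    rw [this, map_zero]
    refine h _ ?_ ?_
    · rw [Function.update_self, Function.update_of_ne hij.symm]
      field_simp
    · rwa [Function.update_of_ne hij.symm]
  let I := Ideal.span {linForm i j q}
  have hmk : (Ideal.Quotient.mkₐ k I).comp φ = Ideal.Quotient.mkₐ k I := by
    ext l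
    by_cases hl : l = i
    · subst hl
      simp only [φ, AlgHom.comp_apply, aeval_X, Function.update_self]
      refine Ideal.Quotient.eq.2 (Ideal.mem_span_singleton.2 ⟨C (-q.2⁻¹), ?_⟩)
      rw [linForm, sub_mul, mul_right_comm, ← C_mul, mul_right_comm, ← C_mul, mul_neg,
        mul_inv_cancel₀ hq, mul_neg, ← div_eq_mul_inv, C_neg, C_neg, C_1]
      ring
    · simp [φ, hl]
  have : Ideal.Quotient.mk I r = 0 := by
    have h2 := congrArg (fun f : BiRing k →ₐ[k] _ => f r) hmk
    simp only [AlgHom.comp_apply, hφ, map_zero] at h2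
    exact h2.symm
  exact Ideal.mem_span_singleton.1 (Ideal.Quotient.eq_zero_iff_mem.1 this)

lemma linForm_dvd [Infinite k] {i j : Fin 4} (hij : i ≠ j) {q : k × k}
    (hq : ¬ (q.1 = 0 ∧ q.2 = 0)) {r : BiRing k}
    (h : ∀ v : Fin 4 → k, ¬ (v i = 0 ∧ v j = 0) → q.2 * v i = q.1 * v j → eval v r = 0) :
    linForm i j q ∣ r := by
  by_cases h2 : q.2 = 0
  · rw [linForm_swap, neg_dvd]
    refine linForm_dvd_of_snd_ne_zero hij.symm (fun h1 => hq ⟨h1, h2⟩) fun v hv hi => ?_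
    exact h v (fun h' => hi h'.1) hv.symm
  · exact linForm_dvd_of_snd_ne_zero hij h2 fun v hv hj => h v (fun h' => hj h'.2) hv

/-- `d` behaves like a form of degree `n` in the two variables `X i, X j`, as a function on the
points where `X j` is nonzero. -/
def IsBinaryForm (i j : Fin 4) (n : ℕ) (d : BiRing k) : Prop :=
  ∀ v : Fin 4 → k, v j ≠ 0 → eval v d = v j ^ n * eval (Function.update 1 i (v i / v j)) d

lemma isBinaryForm_of_mem_zero_left {n : ℕ} {d : BiRing k} (hd : d ∈ gradedPiece k 0 n) :
    IsBinaryForm 2 3 n d := by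
  intro v hv
  have h := eval_smul_of_mem hd 1 (v 3) (Function.update 1 2 (v 2 / v 3))
  simp only [one_pow, one_mul] at h
  rw [← h]
  refine eval_of_mem_zero_left hd _ _ ?_ ?_
  · simp [mul_div_cancel₀ _ hv]
  · simp

lemma isBinaryForm_of_mem_zero_right {n : ℕ} {d : BiRing k} (hd : d ∈ gradedPiece k n 0) :
    IsBinaryForm 0 1 n d := by
  intro v hv
  have h := eval_smul_of_mem hd (v 1) 1 (Function.update 1 0 (v 0 / v 1))
  rw [one_pow, mul_one] at h
  rw [← h]
  refine eval_of_mem_zero_right hd _ _ ?_ ?_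
  · simp [mul_div_cancel₀ _ hv]
  · simp

/-- Over an algebraically closed field, a binary form divides a product of linear forms. -/
lemma IsBinaryForm.dvd_prod_linForm [IsAlgClosed k] {i j : Fin 4} {n : ℕ}
    {d : BiRing k} (hd : IsBinaryForm i j n d) (h0 : d ≠ 0) :
    ∃ L : List (k × k), (∀ q ∈ L, ¬ (q.1 = 0 ∧ q.2 = 0)) ∧ d ∣ (L.map (linForm i j)).prod := by
  let φ : BiRing k →ₐ[k] Polynomial k := aeval (Function.update 1 i Polynomial.X)
  have hφ : ∀ t, (φ d).eval t = eval (Function.update 1 i t) d := by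
    intro t
    rw [polynomial_eval_aeval_eq]
    congr 2
    funext l
    by_cases hl : l = i
    · subst hl; simp
    · simp [hl]
  have hφ0 : φ d ≠ 0 := by
    intro h
    refine h0 (eq_of_eval_eq_of_ne_zero j fun v hv => ?_)
    rw [hd v hv, ← hφ, h]
    simp
  set c := (φ d).leadingCoeff
  have hc : c ≠ 0 := Polynomial.leadingCoeff_ne_zero.2 hφ0
  set l := (φ d).roots.toList with hl
  have hsplit : φ d = Polynomial.C c * (l.map fun a => Polynomial.X - Polynomial.C a).prod := by
    have := (IsAlgClosed.splits (φ d)).eq_prod_roots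
    conv_lhs => rw [this]
    rw [hl, ← Multiset.prod_coe, ← Multiset.map_coe, Multiset.coe_toList]
  refine ⟨l.map (fun a => (a, 1)) ++ List.replicate n (-1, 0), ?_, ?_⟩
  · intro q hq
    rw [List.mem_append, List.mem_map, List.mem_replicate] at hq
    rcases hq with ⟨a, -, rfl⟩ | ⟨-, rfl⟩ <;> simp
  · refine ⟨C c⁻¹ * X j ^ l.length, eq_of_eval_eq_of_ne_zero j fun v hv => ?_⟩
    have hl : ∀ l : List k, (eval v) ((l.map (fun a => (a, 1))).map (linForm i j)).prod =
        v j ^ l.length * (l.map fun a => (v i / v j - a)).prod := by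
      intro l
      induction l with
      | nil => simp
      | cons a l ih =>
        simp only [List.map_cons, List.prod_cons, map_mul, ih, eval_linForm, List.length_cons]
        have : 1 * v i - a * v j = v j * (v i / v j - a) := by field_simp
        rw [this]
        ring
    rw [List.map_append, List.prod_append, map_mul, hl, List.map_replicate, List.prod_replicate,
      map_pow, eval_linForm, map_mul, map_mul, hd v hv, ← hφ, hsplit, Polynomial.eval_mul,
      Polynomial.eval_list_prod, eval_C, map_pow, eval_X, Polynomial.eval_C, List.map_map]
    simp only [Function.comp_def, Polynomial.eval_sub, Polynomial.eval_X, Polynomial.eval_C]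
    field_simp
    simp

/-- If the vectors `E ι` are linearly independent at every point, then a combination of them that
is divisible by a product of linear forms has divisible coefficients: modulo a linear form, a
relation between the `E ι` holds along a line, where it must be trivial. -/
lemma prod_linForm_dvd [Infinite k] {i j : Fin 4} (hij : i ≠ j) {ι κ : Type*} [Fintype ι]
    {E : ι → κ → BiRing k}
    (hE : ∀ v : Fin 4 → k, ¬ (v i = 0 ∧ v j = 0) → ∀ ρ : ι → k,
      (∀ c, ∑ a, ρ a * eval v (E a c) = 0) → ρ = 0)
    (L : List (k × k)) (hL : ∀ q ∈ L, ¬ (q.1 = 0 ∧ q.2 = 0)) {A : κ → BiRing k}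
    {r : ι → BiRing k} (h : ∀ c, (L.map (linForm i j)).prod * A c = ∑ a, r a * E a c) (a : ι) :
    (L.map (linForm i j)).prod ∣ r a := by
  induction L generalizing r with
  | nil => simp
  | cons q L ih =>
    have hq := hL q List.mem_cons_self
    have hdvd : ∀ a, linForm i j q ∣ r a := by
      intro a
      refine linForm_dvd hij hq fun v hv hqv => ?_
      refine congrFun (hE v hv (fun a => eval v (r a)) fun c => ?_) a
      have := congrArg (eval v) (h c)
      rw [List.map_cons, List.prod_cons, map_mul, map_mul, eval_linForm, hqv, sub_self, zero_mul,
        zero_mul, map_sum] at this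
      simp_rw [map_mul] at this
      exact this.symm
    choose r' hr' using hdvd
    rw [List.map_cons, List.prod_cons, hr' a]
    refine mul_dvd_mul_left _ (ih (fun q' hq' => hL q' (List.mem_cons_of_mem _ hq')) fun c => ?_)
    refine mul_left_cancel₀ (linForm_ne_zero hij hq) ?_
    rw [← mul_assoc, Finset.mul_sum, ← List.prod_cons, ← List.map_cons, h c]
    exact Finset.sum_congr rfl fun a _ => by rw [hr' a, mul_assoc]

/-- Pointwise linearly independent vectors generate a saturated module with respect to division
by binary forms. -/
lemma IsBinaryForm.dvd_of_mul_eq_sum [IsAlgClosed k] {i j : Fin 4} (hij : i ≠ j) {n : ℕ}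
    {d : BiRing k} (hd : IsBinaryForm i j n d) (h0 : d ≠ 0) {ι κ : Type*} [Fintype ι]
    {E : ι → κ → BiRing k}
    (hE : ∀ v : Fin 4 → k, ¬ (v i = 0 ∧ v j = 0) → ∀ ρ : ι → k,
      (∀ c, ∑ a, ρ a * eval v (E a c) = 0) → ρ = 0)
    {A : κ → BiRing k} {r : ι → BiRing k} (h : ∀ c, d * A c = ∑ a, r a * E a c) (a : ι) :
    d ∣ r a := by
  obtain ⟨L, hL, e, he⟩ := hd.dvd_prod_linForm h0
  have hprod : (L.map (linForm i j)).prod ≠ 0 := by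
    refine List.prod_ne_zero fun hmem => ?_
    obtain ⟨q, hq, hq0⟩ := List.mem_map.1 hmem
    exact linForm_ne_zero hij (hL q hq) hq0
  have he0 : e ≠ 0 := by
    rintro rfl
    exact hprod (by rw [he, mul_zero])
  have h2 : ∀ c, (L.map (linForm i j)).prod * A c = ∑ a, (e * r a) * E a c := by
    intro c
    rw [he, mul_comm d, mul_assoc, h c, Finset.mul_sum]
    exact Finset.sum_congr rfl fun a _ => by rw [mul_assoc]
  have h3 := prod_linForm_dvd hij hE L hL h2 a
  rw [he, mul_comm d] at h3
  exact (mul_dvd_mul_iff_left he0).1 h3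

/-- A vector parallel to a nowhere vanishing vector of binary forms is a multiple of it. -/
lemma IsBinaryForm.exists_eq_smul [IsAlgClosed k] {i j : Fin 4} (hij : i ≠ j) {n : ℕ}
    {D A : Fin 3 → BiRing k} (hd : ∀ l, IsBinaryForm i j n (D l))
    (hD : ∀ v : Fin 4 → k, ¬ (v i = 0 ∧ v j = 0) → ∃ l, eval v (D l) ≠ 0)
    (h : ∀ l l', D l * A l' = A l * D l') : ∃ r : BiRing k, A = r • D := by
  obtain ⟨l, hl⟩ := hD 1 (by simp)
  have hl0 : D l ≠ 0 := by
    intro h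
    simp [h] at hl
  have := (hd l).dvd_of_mul_eq_sum hij hl0 (ι := Unit) (E := fun _ => D) (r := fun _ => A l)
    (A := A) (fun v hv ρ hρ => ?_) (fun l' => by simpa using h l l') ()
  · obtain ⟨r, hr⟩ := this
    refine ⟨r, funext fun l' => mul_left_cancel₀ hl0 ?_⟩
    rw [h l l', hr, Pi.smul_apply, smul_eq_mul, mul_assoc]
  · obtain ⟨l', hl'⟩ := hD v hv
    have := hρ l'
    simp only [Finset.univ_unique, Finset.sum_singleton, mul_eq_zero, hl', or_false] at this
    funext u
    exact this

/-- A form of positive degree in `z, w` has a zero. -/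
lemma exists_eval_eq_zero [IsAlgClosed k] {n : ℕ} (hn : n ≠ 0) {r : BiRing k}
    (hr : r ∈ gradedPiece k 0 n) :
    ∃ z w : k, ¬ (z = 0 ∧ w = 0) ∧ ∀ x y, eval ![x, y, z, w] r = 0 := by
  suffices h : ∃ z w : k, ¬ (z = 0 ∧ w = 0) ∧ eval ![1, 1, z, w] r = 0 by
    obtain ⟨z, w, hzw, h⟩ := h
    exact ⟨z, w, hzw, fun x y => by
      rw [← h]; exact eval_of_mem_zero_left hr _ _ rfl rfl⟩
  let φ : Polynomial k := aeval (Function.update 1 2 Polynomial.X) r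
  have hφ : ∀ t, φ.eval t = eval (Function.update 1 2 t) r := by
    intro t
    rw [polynomial_eval_aeval_eq]
    congr 2
    funext l
    by_cases hl : l = 2
    · subst hl; simp
    · simp [hl]
  by_cases hdeg : φ.degree = 0
  · -- Then `r` is a scalar multiple of a power of `w`, which vanishes at `(1 : 0)`.
    refine ⟨1, 0, by simp, ?_⟩
    have hr' : r = C (φ.coeff 0) * X 3 ^ n := by
      refine eq_of_eval_eq_of_ne_zero 3 fun v hv => ?_
      rw [isBinaryForm_of_mem_zero_left hr v hv, ← hφ, Polynomial.eq_C_of_degree_eq_zero hdeg]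
      simp [mul_comm]
    rw [hr']
    simp [hn]
  · obtain ⟨t, ht⟩ := IsAlgClosed.exists_root φ hdeg
    refine ⟨t, 1, by simp, ?_⟩
    rw [Polynomial.IsRoot, hφ] at ht
    rw [← ht]
    exact eval_of_mem_zero_left hr _ _ (by simp) (by simp)

/-! ### Vectors in three-space -/

section CrossProduct

variable {A : Type*} [CommRing A]

lemma mul_eq_mul_of_cross_eq_zero {u v : Fin 3 → A} (h : u ⨯₃ v = 0) (l l' : Fin 3) :
    u l * v l' = u l' * v l := by
  rw [cross_apply] at h
  have h0 : u 1 * v 2 - u 2 * v 1 = 0 := congrFun h 0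
  have h1 : u 2 * v 0 - u 0 * v 2 = 0 := congrFun h 1
  have h2 : u 0 * v 1 - u 1 * v 0 = 0 := congrFun h 2
  fin_cases l <;> fin_cases l' <;> simp only [Fin.zero_eta, Fin.mk_one, Fin.reduceFinMk] <;>
    first
    | ring
    | linear_combination h0
    | linear_combination -h0
    | linear_combination h1
    | linear_combination -h1
    | linear_combination h2
    | linear_combination -h2

lemma cross_cross_eq_zero {u v w : Fin 3 → A} (hv : u ⬝ᵥ v = 0) (hw : u ⬝ᵥ w = 0) :
    u ⨯₃ (v ⨯₃ w) = 0 := by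
  rw [cross_cross_eq_smul_sub_smul', hw, dotProduct_comm, hv]
  simp

lemma dotProduct_smul_cross (u a b c : Fin 3 → A) :
    (a ⬝ᵥ b ⨯₃ c) • u = (u ⬝ᵥ a) • b ⨯₃ c - (u ⬝ᵥ b) • a ⨯₃ c + (u ⬝ᵥ c) • a ⨯₃ b := by
  funext l
  fin_cases l <;> simp [cross_apply, dotProduct, Fin.sum_univ_three] <;> ring

lemma exists_eq_smul_of_cross_eq_zero {u v : Fin 3 → k} (hu : u ≠ 0) (h : v ⨯₃ u = 0) :
    ∃ c : k, v = c • u := by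
  obtain ⟨l, hl⟩ := Function.ne_iff.1 hu
  rw [Pi.zero_apply] at hl
  refine ⟨v l / u l, funext fun l' => ?_⟩
  rw [Pi.smul_apply, smul_eq_mul, div_mul_eq_mul_div, eq_div_iff hl,
    mul_eq_mul_of_cross_eq_zero h l' l]

lemma exists_dotProduct_eq_one {u : Fin 3 → k} (hu : u ≠ 0) :
    ∃ v : Fin 3 → k, u ⬝ᵥ v = 1 := by
  obtain ⟨l, hl⟩ := Function.ne_iff.1 hu
  refine ⟨Pi.single l (u l)⁻¹, ?_⟩
  rw [dotProduct_single]
  exact mul_inv_cancel₀ hl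

end CrossProduct

/-! ### Nets of binary quadratic forms without common zeros -/

/-- The quadratic form `x² a + xy b + y² c` with vector coefficients has no nontrivial zero. -/
def IsAnisotropic (a b c : Fin 3 → k) : Prop :=
  ∀ x y : k, ¬ (x = 0 ∧ y = 0) → x ^ 2 • a + (x * y) • b + y ^ 2 • c ≠ 0

namespace IsAnisotropic

variable {a b c : Fin 3 → k} (h : IsAnisotropic a b c)

include h

lemma left_ne_zero : a ≠ 0 := by
  rintro rfl
  exact h 1 0 (by simp) (by simp)

lemma right_ne_zero : c ≠ 0 := by
  rintro rfl
  exact h 0 1 (by simp) (by simp)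

/-- The coefficients span a space of dimension at least two, as a single binary quadratic form has
a zero. -/
lemma cross_ne_zero [IsAlgClosed k] (hab : a ⨯₃ b = 0) (hac : a ⨯₃ c = 0) : False := by
  obtain ⟨β, rfl⟩ := exists_eq_smul_of_cross_eq_zero h.left_ne_zero
    (by rw [← cross_anticomm, hab, neg_zero])
  obtain ⟨γ, rfl⟩ := exists_eq_smul_of_cross_eq_zero h.left_ne_zero
    (by rw [← cross_anticomm, hac, neg_zero])
  obtain ⟨t, ht⟩ := IsAlgClosed.exists_root
    (Polynomial.C 1 * Polynomial.X ^ 2 + Polynomial.C β * Polynomial.X + Polynomial.C γ)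
    (by rw [Polynomial.degree_quadratic one_ne_zero]; decide)
  refine h t 1 (by simp) ?_
  rw [smul_smul, smul_smul, ← add_smul, ← add_smul]
  simp only [Polynomial.IsRoot, Polynomial.eval_add, Polynomial.eval_mul, Polynomial.eval_C,
    Polynomial.eval_pow, Polynomial.eval_X] at ht
  rw [show t ^ 2 + t * 1 * β + 1 ^ 2 * γ = 0 by linear_combination ht, zero_smul]

/-- A linear relation between the coefficients is not on the conic of points `(x² : xy : y²)`. -/
lemma mul_ne_sq {N : Fin 3 → k} (hN : N ≠ 0) (hrel : N 0 • a + N 1 • b + N 2 • c = 0) :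
    N 0 * N 2 - N 1 ^ 2 ≠ 0 := by
  intro hconic
  by_cases h0 : N 0 = 0
  · have h1 : N 1 = 0 := by
      rw [h0, zero_mul, zero_sub, neg_eq_zero] at hconic
      exact pow_eq_zero_iff two_ne_zero |>.1 hconic
    refine h 0 1 (by simp) ?_
    have h2 : N 2 ≠ 0 := fun h2 => hN (by funext l; fin_cases l <;> assumption)
    rw [h0, h1] at hrel
    simpa [h2] using hrel
  · refine h (N 0) (N 1) (fun h' => h0 h'.1) ?_
    rw [show N 1 ^ 2 = N 0 * N 2 by linear_combination -hconic, pow_two, mul_smul, mul_smul,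
      mul_smul, ← smul_add, ← smul_add, hrel, smul_zero]

/-- The two vectors `(a × b, a × c)` and `(a × c, b × c)` are linearly independent. -/
lemma eq_zero_of_cross [IsAlgClosed k] {r s : k} (h1 : r • a ⨯₃ b + s • a ⨯₃ c = 0)
    (h2 : r • a ⨯₃ c + s • b ⨯₃ c = 0) : r = 0 ∧ s = 0 := by
  by_contra hrs
  -- The value at `(r, s)` is a nonzero vector parallel to both `a` and `c`.
  set u := r ^ 2 • a + (r * s) • b + s ^ 2 • c with hu
  have hu0 : u ≠ 0 := h r s hrs
  have hau : a ⨯₃ u = 0 := by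
    have : a ⨯₃ u = s • (r • a ⨯₃ b + s • a ⨯₃ c) := by
      simp only [hu, map_add, map_smul, cross_self, smul_zero, zero_add, smul_add, smul_smul]
      congr 2 <;> ring
    rw [this, h1, smul_zero]
  have huc : c ⨯₃ u = 0 := by
    have : u ⨯₃ c = r • (r • a ⨯₃ c + s • b ⨯₃ c) := by
      simp only [hu, map_add, map_smul, LinearMap.add_apply, LinearMap.smul_apply, cross_self,
        smul_zero, add_zero, smul_add, smul_smul]
      congr 2; ring
    rw [← cross_anticomm, this, h2, smul_zero, neg_zero]
  obtain ⟨α, hα⟩ := exists_eq_smul_of_cross_eq_zero hu0 hau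
  obtain ⟨γ, hγ⟩ := exists_eq_smul_of_cross_eq_zero hu0 huc
  have hac : a ⨯₃ c = 0 := by
    rw [hα, hγ]; simp
  rw [hac, smul_zero, add_zero] at h1
  rw [hac, smul_zero, zero_add] at h2
  rcases smul_eq_zero.1 h1 with hr | hab
  · rcases smul_eq_zero.1 h2 with hs | hbc
    · exact hrs ⟨hr, hs⟩
    · obtain ⟨β, hβ⟩ := exists_eq_smul_of_cross_eq_zero h.right_ne_zero hbc
      refine h.cross_ne_zero ?_ hac
      rw [hβ, map_smul, hac, smul_zero]
  · exact h.cross_ne_zero hab hac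

end IsAnisotropic

/-! ### The pencil attached to the three forms -/

/-- The coefficients in `x, y` of a form of degree `(2, 1)` with vector values: the linear forms
`z F_j + w G_j`. -/
noncomputable def linCoeff (F G : Fin 3 → Fin 3 → k) (j : Fin 3) : Fin 3 → BiRing k :=
  fun i => C (F j i) * X 2 + C (G j i) * X 3

/-- The quadratic form `x² F₀ + xy F₁ + y² F₂`. -/
noncomputable def quadForm (F : Fin 3 → Fin 3 → k) : Fin 3 → BiRing k :=
  fun i => C (F 0 i) * X 0 ^ 2 + C (F 1 i) * (X 0 * X 1) + C (F 2 i) * X 1 ^ 2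

/-- The vector with entries the forms of degree `(2, 1)` with coefficient vectors `F_j, G_j`. -/
noncomputable def netForm (F G : Fin 3 → Fin 3 → k) : Fin 3 → BiRing k :=
  (X 0 ^ 2 : BiRing k) • linCoeff F G 0 + (X 0 * X 1 : BiRing k) • linCoeff F G 1 +
    (X 1 ^ 2 : BiRing k) • linCoeff F G 2

lemma netForm_eq_quadForm (F G : Fin 3 → Fin 3 → k) :
    netForm F G = (X 2 : BiRing k) • quadForm F + (X 3 : BiRing k) • quadForm G := by
  funext i
  simp [netForm, quadForm, linCoeff]
  ring

lemma linCoeff_mem (F G : Fin 3 → Fin 3 → k) (j i : Fin 3) :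
    linCoeff F G j i ∈ gradedPiece k 0 1 :=
  add_mem (C_mul_mem_gradedPiece _ (X_mem_gradedPiece 2))
    (C_mul_mem_gradedPiece _ (X_mem_gradedPiece 3))

lemma quadForm_mem (F : Fin 3 → Fin 3 → k) (i : Fin 3) : quadForm F i ∈ gradedPiece k 2 0 :=
  add_mem (add_mem (C_mul_mem_gradedPiece _ (X_pow_mem_gradedPiece 0 2))
    (C_mul_mem_gradedPiece _ (mul_mem_gradedPiece (X_mem_gradedPiece 0) (X_mem_gradedPiece 1))))
    (C_mul_mem_gradedPiece _ (X_pow_mem_gradedPiece 1 2))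

lemma exists_eq_linear {r : BiRing k} (hr : r ∈ gradedPiece k 0 1) :
    ∃ s t : k, r = C s * X 2 + C t * X 3 := by
  obtain ⟨r', hr', t, ht, rfl⟩ := exists_eq_X_two_mul_add hr
  obtain ⟨c, rfl⟩ := exists_eq_C_of_mem hr'
  obtain ⟨d, rfl⟩ := exists_eq_C_of_mem ht
  exact ⟨c, d, by ring⟩

lemma exists_eq_netForm {p : Fin 3 → BiRing k} (hp : ∀ i, p i ∈ gradedPiece k 2 1) :
    ∃ F G, p = netForm F G := by
  have h : ∀ i, ∃ s t : Fin 3 → k, p i = X 0 ^ 2 * (C (s 0) * X 2 + C (t 0) * X 3) +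
      X 0 * X 1 * (C (s 1) * X 2 + C (t 1) * X 3) + X 1 ^ 2 * (C (s 2) * X 2 + C (t 2) * X 3) := by
    intro i
    obtain ⟨q, hq, c, hc, e⟩ := exists_eq_X_zero_mul_add (hp i)
    obtain ⟨a, ha, b, hb, rfl⟩ := exists_eq_X_zero_mul_add hq
    obtain ⟨s0, t0, rfl⟩ := exists_eq_linear ha
    obtain ⟨s1, t1, rfl⟩ := exists_eq_linear hb
    obtain ⟨s2, t2, rfl⟩ := exists_eq_linear hc
    refine ⟨![s0, s1, s2], ![t0, t1, t2], ?_⟩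
    rw [e]
    simp
    ring
  choose s t hst using h
  refine ⟨fun j i => s i j, fun j i => t i j, funext fun i => ?_⟩
  rw [hst i]
  simp [netForm, linCoeff]

/-- Evaluation of a vector of polynomials. -/
noncomputable def evalVec (v : Fin 4 → k) (A : Fin 3 → BiRing k) : Fin 3 → k :=
  fun i => eval v (A i)

lemma evalVec_cross (v : Fin 4 → k) (A B : Fin 3 → BiRing k) :
    evalVec v (A ⨯₃ B) = evalVec v A ⨯₃ evalVec v B := by
  funext l
  fin_cases l <;> simp [evalVec, cross_apply]

lemma eval_dotProduct (v : Fin 4 → k) (A B : Fin 3 → BiRing k) :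
    eval v (A ⬝ᵥ B) = evalVec v A ⬝ᵥ evalVec v B := by
  simp [dotProduct, evalVec]

lemma evalVec_linCoeff (v : Fin 4 → k) (F G : Fin 3 → Fin 3 → k) (j : Fin 3) :
    evalVec v (linCoeff F G j) = v 2 • F j + v 3 • G j := by
  funext i
  simp [evalVec, linCoeff]
  ring

lemma evalVec_quadForm (v : Fin 4 → k) (F : Fin 3 → Fin 3 → k) :
    evalVec v (quadForm F) = v 0 ^ 2 • F 0 + (v 0 * v 1) • F 1 + v 1 ^ 2 • F 2 := by
  funext i
  simp [evalVec, quadForm]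
  ring

lemma dotProduct_mem_gradedPiece {m n m' n' : ℕ} {A B : Fin 3 → BiRing k}
    (hA : ∀ i, A i ∈ gradedPiece k m n) (hB : ∀ i, B i ∈ gradedPiece k m' n') :
    A ⬝ᵥ B ∈ gradedPiece k (m + m') (n + n') :=
  Submodule.sum_mem _ fun i _ => mul_mem_gradedPiece (hA i) (hB i)

lemma cross_mem_gradedPiece {m n m' n' : ℕ} {A B : Fin 3 → BiRing k}
    (hA : ∀ i, A i ∈ gradedPiece k m n) (hB : ∀ i, B i ∈ gradedPiece k m' n') (i : Fin 3) :
    (A ⨯₃ B) i ∈ gradedPiece k (m + m') (n + n') := by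
  rw [cross_apply]
  fin_cases i <;>
    exact sub_mem (mul_mem_gradedPiece (hA _) (hB _)) (mul_mem_gradedPiece (hA _) (hB _))

lemma mem_Syz {p A : Fin 3 → BiRing k} : A ∈ Syz p ↔ A ⬝ᵥ p = 0 := by
  rw [Syz, LinearMap.mem_ker, Fintype.linearCombination_apply]
  rfl

/-- The forms with coefficient vectors `F_j, G_j` have no common zero on `ℙ¹ × ℙ¹`. -/
def IsBasePointFree (F G : Fin 3 → Fin 3 → k) : Prop :=
  ∀ z w : k, ¬ (z = 0 ∧ w = 0) →
    IsAnisotropic (z • F 0 + w • G 0) (z • F 1 + w • G 1) (z • F 2 + w • G 2)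

lemma isBasePointFree_of_noCommonZeros {F G : Fin 3 → Fin 3 → k}
    (h : NoCommonZeros (netForm F G)) : IsBasePointFree F G := by
  intro z w hzw x y hxy h0
  obtain ⟨i, hi⟩ := h x y z w hxy hzw
  refine hi ?_
  have := congrFun h0 i
  simp only [netForm, linCoeff, Pi.add_apply, Pi.smul_apply, smul_eq_mul, map_add, map_mul, map_pow,
    eval_X, eval_C, Pi.zero_apply] at this ⊢
  simp only [cons_val_zero, cons_val_one, cons_val]
  linear_combination this

namespace IsBasePointFree

variable {F G : Fin 3 → Fin 3 → k} (h : IsBasePointFree F G)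

include h

/-- The vectors `f(x, y)` and `g(x, y)` are independent at every point of `ℙ¹`. -/
lemma evalVec_quadForm_cross_ne_zero (v : Fin 4 → k) (hv : ¬ (v 0 = 0 ∧ v 1 = 0)) :
    evalVec v (quadForm F ⨯₃ quadForm G) ≠ 0 := by
  rw [evalVec_cross, evalVec_quadForm, evalVec_quadForm]
  set f := v 0 ^ 2 • F 0 + (v 0 * v 1) • F 1 + v 1 ^ 2 • F 2 with hf
  set g := v 0 ^ 2 • G 0 + (v 0 * v 1) • G 1 + v 1 ^ 2 • G 2 with hg
  have key : ∀ z w : k, ¬ (z = 0 ∧ w = 0) → z • f + w • g ≠ 0 := by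
    intro z w hzw h0
    refine h z w hzw (v 0) (v 1) hv ?_
    rw [← h0, hf, hg]
    module
  intro hfg
  have hf0 : f ≠ 0 := fun h0 => key 1 0 (by simp) (by simp [h0])
  obtain ⟨c, hc⟩ := exists_eq_smul_of_cross_eq_zero hf0
    (by rw [← cross_anticomm, hfg, neg_zero])
  exact key (-c) 1 (by simp) (by rw [hc]; module)

lemma cross_ne_zero_zero : F 0 ⨯₃ G 0 ≠ 0 := by
  have := h.evalVec_quadForm_cross_ne_zero ![1, 0, 0, 0] (by simp)
  simpa [evalVec_cross, evalVec_quadForm] using this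

lemma cross_ne_zero_two : F 2 ⨯₃ G 2 ≠ 0 := by
  have := h.evalVec_quadForm_cross_ne_zero ![0, 1, 0, 0] (by simp)
  simpa [evalVec_cross, evalVec_quadForm] using this

lemma isAnisotropic_evalVec (v : Fin 4 → k) (hv : ¬ (v 2 = 0 ∧ v 3 = 0)) :
    IsAnisotropic (evalVec v (linCoeff F G 0)) (evalVec v (linCoeff F G 1))
      (evalVec v (linCoeff F G 2)) := by
  rw [evalVec_linCoeff, evalVec_linCoeff, evalVec_linCoeff]
  exact h _ _ hv

end IsBasePointFree

/-! ### Syzygies by degree in `x, y` -/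

lemma mem_gradedPiece_of_mul_mem {m n m' n' : ℕ} {q r : BiRing k} (hq : q ∈ gradedPiece k m' n')
    (hq0 : q ≠ 0) (h : r * q ∈ gradedPiece k (m + m') (n + n')) : r ∈ gradedPiece k m n := by
  have h1 := weightedHomogeneousComponent_mul_right hq (m, n) r
  have h2 : weightedHomogeneousComponent varBidegree ((m, n) + (m', n')) (r * q) = r * q :=
    weightedHomogeneousComponent_eq_self h
  rw [h2] at h1
  rw [mul_right_cancel₀ hq0 h1]
  exact weightedHomogeneousComponent_isWeightedHomogeneous _ _

lemma eq_zero_of_X_zero_mul_add [Infinite k] {n e : ℕ} {r u : BiRing k}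
    (hu : u ∈ gradedPiece k 0 n) (h : X 0 * r + X 1 ^ e * u = 0) : u = 0 ∧ r = 0 := by
  have hu0 : u = 0 := by
    refine MvPolynomial.funext fun v => ?_
    rw [eval_of_mem_zero_left hu v ![0, 1, v 2, v 3] rfl rfl]
    have := congrArg (eval ![0, 1, v 2, v 3]) h
    simpa using this
  refine ⟨hu0, ?_⟩
  rw [hu0, mul_zero, add_zero] at h
  exact (mul_eq_zero.1 h).resolve_left (X_ne_zero 0)

section Strands

variable {F G : Fin 3 → Fin 3 → k}

/-- The syzygies of degree `1` in `z, w` are the multiples of `f × g`. -/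
lemma exists_eq_smul_quadForm_cross [IsAlgClosed k] (h : IsBasePointFree F G)
    {A : Fin 3 → BiRing k} (hA : A ∈ Syz (netForm F G)) {m : ℕ}
    (hm : ∀ i, A i ∈ gradedPiece k m 0) : ∃ r : BiRing k, A = r • (quadForm F ⨯₃ quadForm G) := by
  rw [mem_Syz] at hA
  have key : ∀ (v : Fin 4 → k) (z w : k), z * eval v (A ⬝ᵥ quadForm F) +
      w * eval v (A ⬝ᵥ quadForm G) = 0 := by
    intro v z w
    have h1 := congrArg (eval ![v 0, v 1, z, w]) hA
    have h2 : evalVec ![v 0, v 1, z, w] A = evalVec v A :=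
      funext fun i => eval_of_mem_zero_right (hm i) _ _ rfl rfl
    rw [netForm_eq_quadForm, dotProduct_add, dotProduct_smul, dotProduct_smul, smul_eq_mul,
      smul_eq_mul, map_add, map_mul, map_mul, eval_dotProduct, eval_dotProduct, h2,
      evalVec_quadForm, evalVec_quadForm, eval_X, eval_X, map_zero] at h1
    rw [eval_dotProduct, eval_dotProduct, evalVec_quadForm, evalVec_quadForm]
    exact h1
  have hF : A ⬝ᵥ quadForm F = 0 := MvPolynomial.funext fun v => by
    simpa using key v 1 0
  have hG : A ⬝ᵥ quadForm G = 0 := MvPolynomial.funext fun v => by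
    simpa using key v 0 1
  refine IsBinaryForm.exists_eq_smul (i := 0) (j := 1) (n := 4) (by decide) (fun l => ?_)
    (fun v hv => ?_) fun l l' => ?_
  · exact isBinaryForm_of_mem_zero_right
      (cross_mem_gradedPiece (quadForm_mem F) (quadForm_mem G) l)
  · exact Function.ne_iff.1 (h.evalVec_quadForm_cross_ne_zero v hv)
  · have := mul_eq_mul_of_cross_eq_zero (cross_cross_eq_zero hF hG) l l'
    linear_combination -this

lemma dotProduct_netForm (A : Fin 3 → BiRing k) : A ⬝ᵥ netForm F G =
    X 0 ^ 2 * (A ⬝ᵥ linCoeff F G 0) + X 0 * X 1 * (A ⬝ᵥ linCoeff F G 1) +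
      X 1 ^ 2 * (A ⬝ᵥ linCoeff F G 2) := by
  simp [netForm, dotProduct_add, dotProduct_smul]

/-- A syzygy of degree `(2, *)` is orthogonal to the three coefficient vectors. -/
lemma dotProduct_linCoeff_eq_zero [Infinite k] {A : Fin 3 → BiRing k}
    (hA : A ∈ Syz (netForm F G)) {n : ℕ} (hn : ∀ i, A i ∈ gradedPiece k 0 n) :
    A ⬝ᵥ linCoeff F G 0 = 0 ∧ A ⬝ᵥ linCoeff F G 1 = 0 ∧ A ⬝ᵥ linCoeff F G 2 = 0 := by
  have hmem := fun j => dotProduct_mem_gradedPiece hn (linCoeff_mem F G j)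
  rw [mem_Syz, dotProduct_netForm] at hA
  obtain ⟨h2, hA⟩ := eq_zero_of_X_zero_mul_add (e := 2) (hmem 2)
    (r := X 0 * (A ⬝ᵥ linCoeff F G 0) + X 1 ^ 1 * (A ⬝ᵥ linCoeff F G 1))
    (by linear_combination hA)
  obtain ⟨h1, h0⟩ := eq_zero_of_X_zero_mul_add (hmem 1) hA
  exact ⟨h0, h1, h2⟩

/-- The equations for a syzygy `x α + y β` of degree `(3, *)`. -/
lemma exists_eq_X_smul_add [Infinite k] {A : Fin 3 → BiRing k}
    (hA : A ∈ Syz (netForm F G)) {n : ℕ} (hn : ∀ i, A i ∈ gradedPiece k 1 n) :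
    ∃ α β : Fin 3 → BiRing k, A = (X 0 : BiRing k) • α + (X 1 : BiRing k) • β ∧
      α ⬝ᵥ linCoeff F G 0 = 0 ∧ α ⬝ᵥ linCoeff F G 1 + β ⬝ᵥ linCoeff F G 0 = 0 ∧
      α ⬝ᵥ linCoeff F G 2 + β ⬝ᵥ linCoeff F G 1 = 0 ∧ β ⬝ᵥ linCoeff F G 2 = 0 := by
  choose α hα β hβ hαβ using fun i => exists_eq_X_zero_mul_add (hn i)
  have hA' : A = (X 0 : BiRing k) • α + (X 1 : BiRing k) • β := by
    funext i
    rw [hαβ i]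
    simp
  have hmα := fun j => dotProduct_mem_gradedPiece hα (linCoeff_mem F G j)
  have hmβ := fun j => dotProduct_mem_gradedPiece hβ (linCoeff_mem F G j)
  refine ⟨α, β, hA', ?_⟩
  rw [mem_Syz, dotProduct_netForm, hA'] at hA
  simp only [add_dotProduct, smul_dotProduct, smul_eq_mul] at hA
  obtain ⟨h3, hA⟩ := eq_zero_of_X_zero_mul_add (e := 3) (hmβ 2)
    (r := X 0 * (X 0 * (α ⬝ᵥ linCoeff F G 0) +
        X 1 ^ 1 * (α ⬝ᵥ linCoeff F G 1 + β ⬝ᵥ linCoeff F G 0)) +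
      X 1 ^ 2 * (α ⬝ᵥ linCoeff F G 2 + β ⬝ᵥ linCoeff F G 1))
    (by linear_combination hA)
  obtain ⟨h2, hA⟩ := eq_zero_of_X_zero_mul_add (add_mem (hmα 2) (hmβ 1)) hA
  obtain ⟨h1, h0⟩ := eq_zero_of_X_zero_mul_add (add_mem (hmα 1) (hmβ 0)) hA
  exact ⟨h0, h1, h2, h3⟩

/-- The vector `c = z F₂ + w G₂` is, up to a constant change of basis, `(z, w, 0)`; its syzygies
of positive degree are the Koszul ones. -/
lemma exists_linCoeff_two_cross_eq (hFG : F 2 ⨯₃ G 2 ≠ 0) {n : ℕ} {α : Fin 3 → BiRing k}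
    (hα : ∀ i, α i ∈ gradedPiece k 0 (n + 1)) (h : α ⬝ᵥ linCoeff F G 2 = 0) :
    ∃ v : Fin 3 → BiRing k, (∀ i, v i ∈ gradedPiece k 0 n) ∧ linCoeff F G 2 ⨯₃ v = α := by
  obtain ⟨H, hH⟩ := exists_dotProduct_eq_one hFG
  let F' : Fin 3 → BiRing k := fun i => C (F 2 i)
  let G' : Fin 3 → BiRing k := fun i => C (G 2 i)
  let H' : Fin 3 → BiRing k := fun i => C (H i)
  have hF' : ∀ i, F' i ∈ gradedPiece k 0 0 := fun i => C_mem_gradedPiece _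
  have hG' : ∀ i, G' i ∈ gradedPiece k 0 0 := fun i => C_mem_gradedPiece _
  have hH' : ∀ i, H' i ∈ gradedPiece k 0 0 := fun i => C_mem_gradedPiece _
  have hc : linCoeff F G 2 = (X 2 : BiRing k) • F' + (X 3 : BiRing k) • G' := by
    funext i
    simp [linCoeff, F', G', mul_comm]
  have hdet : F' ⬝ᵥ G' ⨯₃ H' = 1 := by
    have := congrArg (C : k → BiRing k) hH
    rw [C_1] at this
    rw [← this]
    simp only [F', G', H', dotProduct, cross_apply, Fin.sum_univ_three, cons_val_zero,
      cons_val_one, cons_val, map_add, map_mul, map_sub]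
    ring
  have hrel : X 2 * (α ⬝ᵥ F') + X 3 * (α ⬝ᵥ G') = 0 := by
    rw [← h, hc, dotProduct_add, dotProduct_smul, dotProduct_smul, smul_eq_mul, smul_eq_mul]
  have hdvd : (X 3 : BiRing k) ∣ α ⬝ᵥ F' := by
    have h1 : (X 3 : BiRing k) ∣ X 2 * (α ⬝ᵥ F') :=
      ⟨-(α ⬝ᵥ G'), by linear_combination hrel⟩
    refine (X_prime.dvd_or_dvd h1).resolve_left fun h2 => ?_
    have := X_dvd_X.1 h2
    revert this
    decide
  obtain ⟨s, hs⟩ := hdvd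
  have hs' : α ⬝ᵥ G' = -(X 2 * s) := by
    refine mul_left_cancel₀ (X_ne_zero (R := k) (3 : Fin 4)) ?_
    linear_combination hrel - X 2 * hs
  have hsmem : s ∈ gradedPiece k 0 n := by
    refine mem_gradedPiece_of_mul_mem (X_mem_gradedPiece 3) (X_ne_zero _) ?_
    rw [mul_comm, ← hs]
    have := dotProduct_mem_gradedPiece hα hF'
    exact this
  have hαH : α ⬝ᵥ H' ∈ gradedPiece k 0 (n + 1) := by
    have := dotProduct_mem_gradedPiece hα hH'
    exact this
  obtain ⟨t₁, ht₁, t₂, ht₂, ht⟩ := exists_eq_X_two_mul_add hαH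
  refine ⟨s • H' + t₁ • G' - (X 3 ^ n * t₂) • F', fun i => ?_, ?_⟩
  · have h3 : X 3 ^ n * t₂ ∈ gradedPiece k 0 n := by
      have := mul_mem_gradedPiece (X_pow_mem_gradedPiece 3 n) ht₂
      simpa [varBidegree] using this
    exact sub_mem (add_mem (mul_mem_gradedPiece hsmem (hH' i)) (mul_mem_gradedPiece ht₁ (hG' i)))
      (mul_mem_gradedPiece h3 (hF' i))
  · have hexp := dotProduct_smul_cross α F' G' H'
    rw [hdet, one_smul, hs, hs', ht] at hexp
    rw [hexp, hc]
    funext l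
    fin_cases l <;> simp [cross_apply] <;> ring

/-- A submodule that contains the Koszul syzygies and the syzygies of degree `3` in `x, y`
contains all those of degree at least `3` in `x, y` and at least `2` in `z, w`: modulo `x` such a
syzygy is a Koszul one, and what is left after subtracting that is divisible by `x`. -/
lemma mem_of_koszul_of_cubic [Infinite k] (hFG : F 2 ⨯₃ G 2 ≠ 0)
    {L : Submodule (BiRing k) (Fin 3 → BiRing k)}
    (hL : ∀ v, netForm F G ⨯₃ v ∈ L) {n : ℕ}
    (hbase : ∀ A ∈ Syz (netForm F G), (∀ i, A i ∈ gradedPiece k 1 (n + 1)) → A ∈ L)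
    (m : ℕ) {A : Fin 3 → BiRing k} (hA : A ∈ Syz (netForm F G))
    (hm : ∀ i, A i ∈ gradedPiece k (m + 1) (n + 1)) : A ∈ L := by
  induction m generalizing A with
  | zero => exact hbase A hA hm
  | succ m ih =>
    choose A' hA' α hα e using fun i => exists_eq_X_zero_mul_add (hm i)
    let q : Fin 3 → BiRing k :=
      (X 0 : BiRing k) • linCoeff F G 0 + (X 1 : BiRing k) • linCoeff F G 1
    have hq : ∀ i, q i ∈ gradedPiece k 1 1 := fun i =>
      add_mem (mul_mem_gradedPiece (X_mem_gradedPiece 0) (linCoeff_mem F G 0 i))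
        (mul_mem_gradedPiece (X_mem_gradedPiece 1) (linCoeff_mem F G 1 i))
    have hpq : netForm F G = (X 0 : BiRing k) • q + (X 1 ^ 2 : BiRing k) • linCoeff F G 2 := by
      rw [netForm, smul_add, smul_smul, smul_smul, pow_two]
    have hAe : A = (X 0 : BiRing k) • A' + (X 1 ^ (m + 2) : BiRing k) • α := funext e
    have hαc : α ⬝ᵥ linCoeff F G 2 = 0 := by
      refine (eq_zero_of_X_zero_mul_add (e := m + 4)
        (r := A' ⬝ᵥ netForm F G + X 1 ^ (m + 2) * (α ⬝ᵥ q))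
        (dotProduct_mem_gradedPiece hα (linCoeff_mem F G 2)) ?_).1
      rw [mem_Syz, hAe] at hA
      rw [← hA, add_dotProduct, smul_dotProduct, smul_dotProduct, hpq]
      simp only [dotProduct_add, dotProduct_smul, smul_eq_mul]
      ring
    obtain ⟨v, hv, hvα⟩ := exists_linCoeff_two_cross_eq hFG hα hαc
    have hsub : A = (X 1 ^ m : BiRing k) • netForm F G ⨯₃ v +
        (X 0 : BiRing k) • (A' - (X 1 ^ m : BiRing k) • q ⨯₃ v) := by
      rw [hAe, hpq, ← hvα]
      simp only [map_add, map_smul, LinearMap.add_apply, LinearMap.smul_apply]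
      module
    have hkos : netForm F G ⨯₃ v ∈ Syz (netForm F G) := by
      rw [mem_Syz, dotProduct_comm, dot_self_cross]
    rw [hsub]
    refine add_mem (L.smul_mem _ (hL v)) (L.smul_mem _ (ih ?_ fun i => ?_))
    · rw [mem_Syz] at hA hkos ⊢
      rw [hsub, add_dotProduct, smul_dotProduct, hkos, smul_zero, zero_add, smul_dotProduct,
        smul_eq_mul] at hA
      exact (mul_eq_zero.1 hA).resolve_left (X_ne_zero 0)
    · have h1 := cross_mem_gradedPiece hq hv i
      have h2 := mul_mem_gradedPiece (X_pow_mem_gradedPiece 1 m) h1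
      refine sub_mem (hA' i) ?_
      have h3 : m * (varBidegree 1).1 + (1 + 0) = m + 1 := by simp [varBidegree]
      have h4 : m * (varBidegree 1).2 + (1 + n) = n + 1 := by simp [varBidegree, add_comm]
      rw [h3, h4] at h2
      exact h2

end Strands

/-! ### The singular pencil -/

section Pencil

variable {F G : Fin 3 → Fin 3 → k}

/-- The determinant of the pencil of `3 × 3` matrices with rows `z F_j + w G_j`. -/
noncomputable def pencilDet (F G : Fin 3 → Fin 3 → k) : BiRing k :=
  linCoeff F G 0 ⬝ᵥ linCoeff F G 1 ⨯₃ linCoeff F G 2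

lemma pencilDet_mem (F G : Fin 3 → Fin 3 → k) : pencilDet F G ∈ gradedPiece k 0 3 :=
  dotProduct_mem_gradedPiece (linCoeff_mem F G 0)
    (cross_mem_gradedPiece (linCoeff_mem F G 1) (linCoeff_mem F G 2))

lemma exists_minor_ne_zero [IsAlgClosed k] (h : IsBasePointFree F G) (v : Fin 4 → k)
    (hv : ¬ (v 2 = 0 ∧ v 3 = 0)) :
    evalVec v (linCoeff F G 0 ⨯₃ linCoeff F G 1) ≠ 0 ∨
      evalVec v (linCoeff F G 0 ⨯₃ linCoeff F G 2) ≠ 0 := by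
  by_contra! h0
  rw [evalVec_cross, evalVec_cross] at h0
  exact (h.isAnisotropic_evalVec v hv).cross_ne_zero h0.1 h0.2

/-- A nonzero relation of degree `d + 1` with form coefficients is divisible by a linear form:
the form `N₀ N₂ - N₁²` has a zero, and at this zero the relation has to vanish. -/
lemma exists_relation_of_lower_degree [IsAlgClosed k] (h : IsBasePointFree F G) {d : ℕ}
    {N : Fin 3 → BiRing k} (hN : ∀ l, N l ∈ gradedPiece k 0 (d + 1)) (hN0 : N ≠ 0)
    (hrel : N 0 • linCoeff F G 0 + N 1 • linCoeff F G 1 + N 2 • linCoeff F G 2 = 0) :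
    ∃ N' : Fin 3 → BiRing k, (∀ l, N' l ∈ gradedPiece k 0 d) ∧ N' ≠ 0 ∧
      N' 0 • linCoeff F G 0 + N' 1 • linCoeff F G 1 + N' 2 • linCoeff F G 2 = 0 := by
  have hQ : N 0 * N 2 - N 1 ^ 2 ∈ gradedPiece k 0 (d + 1 + (d + 1)) := by
    rw [pow_two]
    exact sub_mem (mul_mem_gradedPiece (hN 0) (hN 2)) (mul_mem_gradedPiece (hN 1) (hN 1))
  obtain ⟨z, w, hzw, hQ0⟩ := exists_eval_eq_zero (by omega) hQ
  have hrel' : ∀ v, eval v (N 0) • evalVec v (linCoeff F G 0) +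
      eval v (N 1) • evalVec v (linCoeff F G 1) +
      eval v (N 2) • evalVec v (linCoeff F G 2) = 0 := by
    intro v
    funext i
    have := congrArg (eval v) (congrFun hrel i)
    simpa [evalVec] using this
  have hvan : evalVec ![0, 0, z, w] N = 0 := by
    by_contra hne
    refine (h.isAnisotropic_evalVec ![0, 0, z, w] hzw).mul_ne_sq hne (hrel' _) ?_
    have := hQ0 0 0
    rwa [map_sub, map_mul, map_pow] at this
  have hdvd : ∀ l, linForm 2 3 (z, w) ∣ N l := by
    intro l
    refine linForm_dvd (by decide) hzw fun v hv hvz => ?_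
    obtain ⟨t, h2, h3⟩ : ∃ t, v 2 = t * z ∧ v 3 = t * w := by
      simp only at hvz
      by_cases hz : z = 0
      · have hw : w ≠ 0 := fun hw => hzw ⟨hz, hw⟩
        refine ⟨v 3 / w, ?_, by field_simp⟩
        rw [hz, zero_mul] at hvz
        rw [hz, mul_zero]
        exact (mul_eq_zero.1 hvz).resolve_left hw
      · refine ⟨v 2 / z, by field_simp, ?_⟩
        field_simp
        linear_combination -hvz
    have h1 := eval_smul_of_mem (hN l) 1 t ![0, 0, z, w]
    rw [eval_of_mem_zero_left (hN l) v ![1 * 0, 1 * 0, t * z, t * w] h2 h3]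
    refine h1.trans ?_
    rw [show eval ![0, 0, z, w] (N l) = 0 from congrFun hvan l, mul_zero]
  choose N' hN' using hdvd
  have hl : linForm 2 3 (z, w) ≠ 0 := linForm_ne_zero (by decide) hzw
  have hlmem : linForm 2 3 (z, w) ∈ gradedPiece k 0 1 :=
    sub_mem (C_mul_mem_gradedPiece _ (X_mem_gradedPiece 2))
      (C_mul_mem_gradedPiece _ (X_mem_gradedPiece 3))
  refine ⟨N', fun l => mem_gradedPiece_of_mul_mem hlmem hl ?_, ?_, ?_⟩
  · rw [mul_comm, ← hN']
    exact hN l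
  · rintro rfl
    exact hN0 (funext fun l => by rw [hN']; simp)
  · refine (smul_eq_zero.1 (?_ : linForm 2 3 (z, w) • _ = _)).resolve_left hl
    rw [← hrel, hN' 0, hN' 1, hN' 2, smul_add, smul_add, smul_smul, smul_smul, smul_smul]

/-- If the determinant vanishes, then the coefficient vectors satisfy a constant linear relation,
which is not on the conic of points `(x² : xy : y²)`. -/
lemma exists_const_relation [IsAlgClosed k] (h : IsBasePointFree F G) (hdet : pencilDet F G = 0) :
    ∃ N : Fin 3 → k, N 0 * N 2 - N 1 ^ 2 ≠ 0 ∧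
      (C (N 0) : BiRing k) • linCoeff F G 0 + (C (N 1) : BiRing k) • linCoeff F G 1 +
        (C (N 2) : BiRing k) • linCoeff F G 2 = 0 := by
  have hconst : ∀ d, ∀ N : Fin 3 → BiRing k, (∀ l, N l ∈ gradedPiece k 0 d) → N ≠ 0 →
      N 0 • linCoeff F G 0 + N 1 • linCoeff F G 1 + N 2 • linCoeff F G 2 = 0 →
      ∃ N : Fin 3 → k, N ≠ 0 ∧
      (C (N 0) : BiRing k) • linCoeff F G 0 + (C (N 1) : BiRing k) • linCoeff F G 1 +
        (C (N 2) : BiRing k) • linCoeff F G 2 = 0 := by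
    intro d
    induction d with
    | zero =>
      intro N hN hN0 hrel
      choose c hc using fun l => exists_eq_C_of_mem (hN l)
      refine ⟨c, ?_, by rwa [← hc, ← hc, ← hc]⟩
      rintro rfl
      exact hN0 (funext fun l => by rw [hc]; simp)
    | succ d ih =>
      intro N hN hN0 hrel
      obtain ⟨N', h1, h2, h3⟩ := exists_relation_of_lower_degree h hN hN0 hrel
      exact ih N' h1 h2 h3
  obtain ⟨N, hN0, hrel⟩ : ∃ N : Fin 3 → k, N ≠ 0 ∧
      (C (N 0) : BiRing k) • linCoeff F G 0 + (C (N 1) : BiRing k) • linCoeff F G 1 +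
        (C (N 2) : BiRing k) • linCoeff F G 2 = 0 := by
    -- The columns of the adjugate matrix are relations, and one of them is nonzero.
    set a := linCoeff F G 0
    set b := linCoeff F G 1
    set c := linCoeff F G 2
    have hcol : ∃ l, ![(b ⨯₃ c) l, -(a ⨯₃ c) l, (a ⨯₃ b) l] ≠ 0 := by
      by_contra! h0
      have h1 : a ⨯₃ b = 0 := funext fun l => congrFun (h0 l) 2
      have h2 : a ⨯₃ c = 0 := funext fun l => neg_eq_zero.1 (congrFun (h0 l) 1)
      rcases exists_minor_ne_zero h 1 (by simp) with h' | h' <;> apply h'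
      · rw [h1]; funext i; simp [evalVec]
      · rw [h2]; funext i; simp [evalVec]
    obtain ⟨l, hl⟩ := hcol
    refine hconst 2 _ (fun j => ?_) hl ?_
    · have hm := fun i j => cross_mem_gradedPiece (linCoeff_mem F G i) (linCoeff_mem F G j) l
      fin_cases j
      · exact hm 1 2
      · exact neg_mem (hm 0 2)
      · exact hm 0 1
    · have hd : a 0 * (b 1 * c 2 - b 2 * c 1) + a 1 * (b 2 * c 0 - b 0 * c 2) +
          a 2 * (b 0 * c 1 - b 1 * c 0) = 0 := by
        rw [← hdet, pencilDet]
        simp [dotProduct, cross_apply, Fin.sum_univ_three, a, b, c]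
      funext i
      fin_cases l <;> fin_cases i <;> simp [cross_apply] <;>
        first
        | linear_combination hd
        | ring
  refine ⟨N, ?_, hrel⟩
  refine (h.isAnisotropic_evalVec 1 (by simp)).mul_ne_sq hN0 ?_
  funext i
  have := congrArg (eval 1) (congrFun hrel i)
  simpa [evalVec] using this

/-- If the determinant vanishes, then the `2 × 2` minors are constant multiples of one vector `D`
of forms of degree `2` in `z, w`. -/
lemma exists_minors_eq_smul [IsAlgClosed k] (h : IsBasePointFree F G) (hdet : pencilDet F G = 0) :
    ∃ (N : Fin 3 → k) (D : Fin 3 → BiRing k), N 0 * N 2 - N 1 ^ 2 ≠ 0 ∧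
      (C (N 0) : BiRing k) • linCoeff F G 0 + (C (N 1) : BiRing k) • linCoeff F G 1 +
        (C (N 2) : BiRing k) • linCoeff F G 2 = 0 ∧
      (∀ i, D i ∈ gradedPiece k 0 2) ∧
      linCoeff F G 0 ⨯₃ linCoeff F G 1 = (C (N 2) : BiRing k) • D ∧
      linCoeff F G 0 ⨯₃ linCoeff F G 2 = -(C (N 1) : BiRing k) • D ∧
      linCoeff F G 1 ⨯₃ linCoeff F G 2 = (C (N 0) : BiRing k) • D := by
  obtain ⟨N, hN, hrel⟩ := exists_const_relation h hdet
  have hm := fun i j => cross_mem_gradedPiece (linCoeff_mem F G i) (linCoeff_mem F G j)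
  set a := linCoeff F G 0
  set b := linCoeff F G 1
  set c := linCoeff F G 2
  have h1 : (C (N 1) : BiRing k) • a ⨯₃ b + (C (N 2) : BiRing k) • a ⨯₃ c = 0 := by
    have := congrArg (a ⨯₃ ·) hrel
    simpa using this
  have h2 : -((C (N 0) : BiRing k) • a ⨯₃ b) + (C (N 2) : BiRing k) • b ⨯₃ c = 0 := by
    have := congrArg (b ⨯₃ ·) hrel
    simp only [map_add, map_smul, cross_self, smul_zero, add_zero, map_zero] at this
    rw [← this, ← cross_anticomm a b, smul_neg]
  have h3 : (C (N 0) : BiRing k) • a ⨯₃ c + (C (N 1) : BiRing k) • b ⨯₃ c = 0 := by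
    have := congrArg (· ⨯₃ c) hrel
    simpa using this
  have hinv : ∀ l, N l ≠ 0 → (C (N l)⁻¹ : BiRing k) * C (N l) = 1 := fun l hl => by
    rw [← C_mul, inv_mul_cancel₀ hl, C_1]
  by_cases h20 : N 2 = 0
  · have h10 : N 1 ≠ 0 := by
      intro h10
      exact hN (by rw [h10, h20]; ring)
    refine ⟨N, -(C (N 1)⁻¹ : BiRing k) • a ⨯₃ c, hN, hrel, fun i => ?_, ?_, ?_, ?_⟩
    · rw [neg_smul]
      exact neg_mem (C_mul_mem_gradedPiece _ (hm 0 2 i))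
    · rw [h20, C_0, zero_smul, add_zero] at h1
      rw [h20, C_0, zero_smul]
      linear_combination (norm := module) (C (N 1)⁻¹ : BiRing k) • h1 - hinv 1 h10 • (a ⨯₃ b)
    · linear_combination (norm := module) -hinv 1 h10 • (a ⨯₃ c)
    · linear_combination (norm := module) (C (N 1)⁻¹ : BiRing k) • h3 - hinv 1 h10 • (b ⨯₃ c)
  · refine ⟨N, (C (N 2)⁻¹ : BiRing k) • a ⨯₃ b, hN, hrel,
      fun i => C_mul_mem_gradedPiece _ (hm 0 1 i), ?_, ?_, ?_⟩
    · linear_combination (norm := module) -hinv 2 h20 • (a ⨯₃ b)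
    · linear_combination (norm := module) (C (N 2)⁻¹ : BiRing k) • h1 - hinv 2 h20 • (a ⨯₃ c)
    · linear_combination (norm := module) (C (N 2)⁻¹ : BiRing k) • h2 - hinv 2 h20 • (b ⨯₃ c)

end Pencil

/-! ### Generators of the syzygy module -/

/-- The syzygies form a graded module, so inclusions may be checked on bihomogeneous elements. -/
lemma Syz_le_of_bihomogeneous {p : Fin 3 → BiRing k} (hp : ∀ i, p i ∈ gradedPiece k 2 1)
    {L : Submodule (BiRing k) (Fin 3 → BiRing k)}
    (hL : ∀ A ∈ Syz p, ∀ m n, (∀ i, A i ∈ gradedPiece k m n) → A ∈ L) : Syz p ≤ L := by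
  classical
  intro A hA
  let D : Finset (ℕ × ℕ) :=
    Finset.univ.biUnion fun i => (A i).support.image (Finsupp.weight varBidegree)
  have hsum : A = ∑ d ∈ D, fun i => weightedHomogeneousComponent varBidegree d (A i) := by
    funext i
    rw [Finset.sum_apply]
    ext s
    simp only [coeff_sum, coeff_weightedHomogeneousComponent, Finset.sum_ite_eq]
    split_ifs with hs
    · rfl
    · by_contra h
      exact hs (Finset.mem_biUnion.2 ⟨i, Finset.mem_univ i,
        Finset.mem_image_of_mem _ (mem_support_iff.2 h)⟩)
  rw [hsum]
  refine Submodule.sum_mem _ fun d _ => hL _ ?_ d.1 d.2 fun i =>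
    weightedHomogeneousComponent_isWeightedHomogeneous _ _
  rw [mem_Syz] at hA ⊢
  have := congrArg (weightedHomogeneousComponent varBidegree (d + (2, 1))) hA
  rw [map_zero, dotProduct, map_sum] at this
  rw [← this, dotProduct]
  exact Finset.sum_congr rfl fun i _ => (weightedHomogeneousComponent_mul_right (hp i) d _).symm

lemma netForm_mem (F G : Fin 3 → Fin 3 → k) (i : Fin 3) : netForm F G i ∈ gradedPiece k 2 1 := by
  rw [netForm_eq_quadForm]
  exact add_mem (by simpa [varBidegree] using
      mul_mem_gradedPiece (X_mem_gradedPiece 2) (quadForm_mem F i))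
    (by simpa [varBidegree] using mul_mem_gradedPiece (X_mem_gradedPiece 3) (quadForm_mem G i))

/-- The Koszul syzygies `p × e_i`. -/
noncomputable def koszul (p : Fin 3 → BiRing k) (i : Fin 3) : Fin 3 → BiRing k :=
  p ⨯₃ Pi.single i 1

lemma cross_eq_sum_koszul (p v : Fin 3 → BiRing k) :
    p ⨯₃ v = v 0 • koszul p 0 + v 1 • koszul p 1 + v 2 • koszul p 2 := by
  simp only [koszul]
  rw [← map_smul, ← map_smul, ← map_smul, ← map_add, ← map_add]
  congr 1
  funext l
  fin_cases l <;> simp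

section Generators

variable {F G : Fin 3 → Fin 3 → k}

lemma hasBidegree_quadForm_cross (F G : Fin 3 → Fin 3 → k) :
    HasBidegree (quadForm F ⨯₃ quadForm G) (6, 1) :=
  hasBidegree_add_iff.2 (cross_mem_gradedPiece (quadForm_mem F) (quadForm_mem G))

lemma hasBidegree_koszul (F G : Fin 3 → Fin 3 → k) (i : Fin 3) :
    HasBidegree (koszul (netForm F G) i) (4, 2) := by
  refine hasBidegree_add_iff.2 fun l => ?_
  refine cross_mem_gradedPiece (m' := 0) (n' := 0) (netForm_mem F G) (fun j => ?_) l
  by_cases hj : j = i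
  · subst hj
    simpa using C_mem_gradedPiece (1 : k)
  · rw [Pi.single_eq_of_ne hj]
    exact zero_mem _

lemma quadForm_cross_mem_Syz (F G : Fin 3 → Fin 3 → k) :
    quadForm F ⨯₃ quadForm G ∈ Syz (netForm F G) := by
  rw [mem_Syz, netForm_eq_quadForm, dotProduct_comm, add_dotProduct, smul_dotProduct,
    smul_dotProduct, dot_self_cross, dot_cross_self, smul_zero, smul_zero, add_zero]

lemma koszul_mem_Syz (p : Fin 3 → BiRing k) (i : Fin 3) : koszul p i ∈ Syz p := by
  rw [mem_Syz, dotProduct_comm, koszul, dot_self_cross]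

lemma quadForm_cross_ne_zero (h : IsBasePointFree F G) : quadForm F ⨯₃ quadForm G ≠ 0 := by
  intro h0
  refine h.evalVec_quadForm_cross_ne_zero 1 (by simp) ?_
  rw [h0]
  funext i
  simp [evalVec]

lemma linearIndependent_koszul (h : IsBasePointFree F G) :
    LinearIndependent k (koszul (netForm F G)) := by
  rw [Fintype.linearIndependent_iff]
  intro c hc
  have h1 : netForm F G ⨯₃ (fun i => C (c i)) = 0 := by
    rw [cross_eq_sum_koszul, ← hc, Fin.sum_univ_three]
    simp only [← algebraMap_eq, algebraMap_smul]
  have h2 : ∀ z w : k, (z • F 0 + w • G 0) ⨯₃ c = 0 := by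
    intro z w
    have h3 := evalVec_cross ![1, 0, z, w] (netForm F G) (fun i => C (c i))
    have h4 : evalVec ![1, 0, z, w] (fun i => (C (c i) : BiRing k)) = c := by
      funext i; simp [evalVec]
    have h5 : evalVec ![1, 0, z, w] (netForm F G) = z • F 0 + w • G 0 := by
      funext i; simp [evalVec, netForm, linCoeff, mul_comm]
    rw [h4, h5, h1] at h3
    rw [← h3]
    funext i
    simp [evalVec]
  by_contra! hne
  have hc0 : c ≠ 0 := by
    rintro rfl
    simp at hne
  obtain ⟨s, hs⟩ := exists_eq_smul_of_cross_eq_zero hc0 (by simpa using h2 1 0)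
  obtain ⟨t, ht⟩ := exists_eq_smul_of_cross_eq_zero hc0 (by simpa using h2 0 1)
  refine h.cross_ne_zero_zero ?_
  rw [hs, ht]
  simp

lemma encard_range_fin {n : ℕ} {f : Fin n → Fin 3 → BiRing k} (hf : Function.Injective f) :
    (Set.range f).encard = n := by
  rw [← Set.image_univ, hf.encard_image, Set.encard_univ]
  simp

lemma eq_zero_of_mem_Syz_of_lt [IsAlgClosed k] (h : IsBasePointFree F G) {A : Fin 3 → BiRing k}
    (hA : A ∈ Syz (netForm F G)) {m : ℕ} (hm : m < 4) (hmem : ∀ i, A i ∈ gradedPiece k m 0) :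
    A = 0 := by
  obtain ⟨r, hr⟩ := exists_eq_smul_quadForm_cross h hA hmem
  refine eq_zero_of_mem_span (S := {quadForm F ⨯₃ quadForm G}) ?_
    (Submodule.mem_span_singleton.2 ⟨r, hr.symm⟩) (hasBidegree_add_iff.2 hmem)
  rintro s rfl
  refine ⟨_, fun hle => ?_, hasBidegree_quadForm_cross F G⟩
  have := hle.1
  simp only at this
  omega

/-- Besides `f × g` and the Koszul syzygies, minimal generators are only needed in degrees `2` and
`3` in `x, y`. If the syzygies there are generated by independent elements of one bidegree, then
all bidegrees of minimal generators are determined. -/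
lemma minimalGeneratingSets_of_low_strands [IsAlgClosed k] (h : IsBasePointFree F G)
    {V : Set (Fin 3 → BiRing k)} {d : ℕ × ℕ} (hd : d = (3, 3) ∨ d = (2, 3)) (hfin : V.Finite)
    (hV : ∀ t ∈ V, HasBidegree t d) (hVS : V ⊆ Syz (netForm F G)) (hind : LinearIndepOn k id V)
    (hlow : ∀ A ∈ Syz (netForm F G), ∀ m n, m ≤ 1 → (∀ i, A i ∈ gradedPiece k m n) →
      A ∈ Submodule.span (BiRing k) V) :
    (∃ S, IsMinimalGeneratingSet (netForm F G) S) ∧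
      ∀ S, IsMinimalGeneratingSet (netForm F G) S →
        S.encard = 1 + 3 + V.encard ∧
        {A ∈ S | HasBidegree A (6, 1)}.encard = 1 ∧
        {A ∈ S | HasBidegree A (4, 2)}.encard = 3 ∧
        {A ∈ S | HasBidegree A d}.encard = V.encard := by
  have hkos := linearIndependent_koszul h
  have hcardkos : (Set.range (koszul (netForm F G))).encard = 3 := encard_range_fin hkos.injective
  let U : Fin 3 → Set (Fin 3 → BiRing k) :=
    ![{quadForm F ⨯₃ quadForm G}, Set.range (koszul (netForm F G)), V]
  have hspan : Submodule.span (BiRing k) (⋃ j, U j) = Syz (netForm F G) := by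
    set L := Submodule.span (BiRing k) (⋃ j, U j)
    have hU : ∀ j, U j ⊆ L := fun j => (Set.subset_iUnion U j).trans Submodule.subset_span
    refine le_antisymm (Submodule.span_le.2 (Set.iUnion_subset fun j => ?_))
      (Syz_le_of_bihomogeneous (netForm_mem F G) fun A hA m n hmn => ?_)
    · fin_cases j
      · rintro _ rfl
        exact quadForm_cross_mem_Syz F G
      · rintro _ ⟨i, rfl⟩
        exact koszul_mem_Syz _ i
      · exact hVS
    · have hVL : Submodule.span (BiRing k) V ≤ L := Submodule.span_le.2 (hU 2)
      have hkosL : ∀ v, netForm F G ⨯₃ v ∈ L := by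
        intro v
        rw [cross_eq_sum_koszul]
        have hi : ∀ i, koszul (netForm F G) i ∈ L := fun i => hU 1 ⟨i, rfl⟩
        exact add_mem (add_mem (L.smul_mem _ (hi 0)) (L.smul_mem _ (hi 1))) (L.smul_mem _ (hi 2))
      match m, n with
      | m, 0 =>
        obtain ⟨r, rfl⟩ := exists_eq_smul_quadForm_cross h hA hmn
        exact L.smul_mem _ (hU 0 rfl)
      | 0, n + 1 => exact hVL (hlow A hA 0 _ zero_le_one hmn)
      | m + 1, n + 1 =>
        exact mem_of_koszul_of_cubic h.cross_ne_zero_two hkosL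
          (fun A hA hmn => hVL (hlow A hA 1 _ le_rfl hmn)) m hA hmn
  have hd2 : d.2 = 3 := by rcases hd with rfl | rfl <;> rfl
  have hvan : ∀ A ∈ Syz (netForm F G), ∀ m n, (n = 0 ∧ m < 4 ∨ m ≤ 1 ∧ ¬ d ≤ (m + 2, n + 1)) →
      HasBidegree A (m + 2, n + 1) → A = 0 := by
    rintro A hA m n (⟨rfl, hm⟩ | ⟨hm, hn⟩) hdeg
    · exact eq_zero_of_mem_Syz_of_lt h hA hm (hasBidegree_add_iff.1 hdeg)
    · exact eq_zero_of_mem_span (fun s hs => ⟨d, hn, hV s hs⟩)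
        (hlow A hA m n hm (hasBidegree_add_iff.1 hdeg)) hdeg
  have hinj : Function.Injective ![((6, 1) : ℕ × ℕ), (4, 2), d] := by
    rcases hd with rfl | rfl <;> decide
  have hfinU : ∀ j, (U j).Finite := by
    intro j
    fin_cases j
    · exact Set.finite_singleton _
    · exact Set.finite_range _
    · exact hfin
  have hdegU : ∀ j, ∀ t ∈ U j, HasBidegree t (![((6, 1) : ℕ × ℕ), (4, 2), d] j) := by
    intro j
    fin_cases j
    · rintro _ rfl
      exact hasBidegree_quadForm_cross F G
    · rintro _ ⟨i, rfl⟩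
      exact hasBidegree_koszul F G i
    · exact hV
  have hindU : ∀ j, LinearIndepOn k id (U j) := by
    intro j
    fin_cases j
    · exact LinearIndepOn.singleton (quadForm_cross_ne_zero h)
    · exact hkos.linearIndepOn_id
    · exact hind
  have hlowU : ∀ j, ∀ A ∈ Syz (netForm F G), ∀ e ≤ ![((6, 1) : ℕ × ℕ), (4, 2), d] j,
      e ≠ ![((6, 1) : ℕ × ℕ), (4, 2), d] j → HasBidegree A e → A = 0 := by
    intro j A hA e he hne hdeg
    obtain rfl | ⟨m, n, rfl⟩ := hdeg.eq_zero_or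
    · rfl
    refine hvan A hA m n ?_ hdeg
    have hle1 := he.1
    have hle2 := he.2
    fin_cases j
    · left
      simp at hle1 hle2 hne
      omega
    · simp at hle1 hle2 hne
      by_cases hn : n = 0
      · left; omega
      · refine Or.inr ⟨by omega, fun hle => ?_⟩
        have := hle.2
        simp only [hd2] at this
        omega
    · refine Or.inr ⟨?_, fun hle => hne (le_antisymm he hle)⟩
      rcases hd with rfl | rfl <;> simp at hle1 <;> omega
  obtain ⟨hex, hall⟩ := minimalGeneratingSets_of_three_bidegrees hinj hfinU hdegU hspan hindU hlowU
  refine ⟨hex, fun S hS => ?_⟩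
  obtain ⟨h1, h2⟩ := hall S hS
  refine ⟨?_, ?_, ?_, h2 2⟩
  · rw [h1]
    simp only [U, cons_val_zero, cons_val_one, cons_val, hcardkos, Set.encard_singleton]
  · exact (h2 0).trans (Set.encard_singleton _)
  · exact (h2 1).trans hcardkos

/-! ### The extra generators -/

/-- The two syzygies of degree `(3, 3)` built from the minors of the pencil. -/
noncomputable def cubicSyzygy (F G : Fin 3 → Fin 3 → k) : Fin 2 → Fin 3 → BiRing k :=
  ![(X 0 : BiRing k) • linCoeff F G 0 ⨯₃ linCoeff F G 1 +
      (X 1 : BiRing k) • linCoeff F G 0 ⨯₃ linCoeff F G 2,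
    (X 0 : BiRing k) • linCoeff F G 0 ⨯₃ linCoeff F G 2 +
      (X 1 : BiRing k) • linCoeff F G 1 ⨯₃ linCoeff F G 2]

lemma cubicSyzygy_mem_Syz (F G : Fin 3 → Fin 3 → k) (j : Fin 2) :
    cubicSyzygy F G j ∈ Syz (netForm F G) := by
  rw [mem_Syz, dotProduct_netForm]
  fin_cases j <;>
    simp [cubicSyzygy, dotProduct, cross_apply, Fin.sum_univ_three] <;> ring

lemma hasBidegree_cubicSyzygy (F G : Fin 3 → Fin 3 → k) (j : Fin 2) :
    HasBidegree (cubicSyzygy F G j) (3, 3) := by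
  refine hasBidegree_add_iff.2 fun i => ?_
  have hm := fun i j => cross_mem_gradedPiece (linCoeff_mem F G i) (linCoeff_mem F G j)
  fin_cases j <;>
    exact add_mem (mul_mem_gradedPiece (X_mem_gradedPiece 0) (hm _ _ i))
      (mul_mem_gradedPiece (X_mem_gradedPiece 1) (hm _ _ i))

lemma linearIndependent_cubicSyzygy [IsAlgClosed k] (h : IsBasePointFree F G) :
    LinearIndependent k (cubicSyzygy F G) := by
  rw [Fintype.linearIndependent_iff]
  intro c hc
  rw [Fin.sum_univ_two] at hc
  have key : ∀ x y : k, c 0 • (x • F 0 ⨯₃ F 1 + y • F 0 ⨯₃ F 2) +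
      c 1 • (x • F 0 ⨯₃ F 2 + y • F 1 ⨯₃ F 2) = 0 := by
    intro x y
    have hev : ∀ i j, evalVec ![x, y, 1, 0] (linCoeff F G i ⨯₃ linCoeff F G j) =
        F i ⨯₃ F j := by
      intro i j
      rw [evalVec_cross, evalVec_linCoeff, evalVec_linCoeff]
      simp
    funext l
    have h1 := congrArg (eval ![x, y, 1, 0]) (congrFun hc l)
    simp only [cubicSyzygy, cons_val_zero, cons_val_one, Pi.add_apply, Pi.smul_apply, smul_eq_mul,
      map_add, smul_eval, map_mul, eval_X, Pi.zero_apply, map_zero] at h1 ⊢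
    rw [← hev, ← hev, ← hev]
    exact h1
  have haniso := h 1 0 (by simp)
  simp only [one_smul, zero_smul, add_zero] at haniso
  have := haniso.eq_zero_of_cross (r := c 0) (s := c 1) (by simpa using key 1 0)
    (by simpa using key 0 1)
  intro i
  fin_cases i
  · exact this.1
  · exact this.2

/-- When the pencil is nonsingular, the syzygies of degree `3` in `x, y` are generated by the two
of degree `(3, 3)`. By Cramer's rule this holds after multiplication by the determinant, which can
be cancelled as the two generators are independent at every point. -/
lemma mem_span_cubicSyzygy [IsAlgClosed k] (h : IsBasePointFree F G) (hdet : pencilDet F G ≠ 0)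
    {A : Fin 3 → BiRing k} (hA : A ∈ Syz (netForm F G)) {n : ℕ}
    (hn : ∀ i, A i ∈ gradedPiece k 1 n) :
    A ∈ Submodule.span (BiRing k) (Set.range (cubicSyzygy F G)) := by
  obtain ⟨α, β, rfl, h0, h1, h2, h3⟩ := exists_eq_X_smul_add hA hn
  have hα := dotProduct_smul_cross α (linCoeff F G 0) (linCoeff F G 1) (linCoeff F G 2)
  have hβ := dotProduct_smul_cross β (linCoeff F G 0) (linCoeff F G 1) (linCoeff F G 2)
  rw [← pencilDet, h0, zero_smul, zero_sub] at hα
  rw [← pencilDet, h3, zero_smul, add_zero, eq_neg_of_add_eq_zero_right h1,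
    eq_neg_of_add_eq_zero_right h2] at hβ
  set a := linCoeff F G 0
  set b := linCoeff F G 1
  set c := linCoeff F G 2
  let E : Fin 2 → Fin 3 ⊕ Fin 3 → BiRing k :=
    ![Sum.elim (a ⨯₃ b) (a ⨯₃ c), Sum.elim (a ⨯₃ c) (b ⨯₃ c)]
  have hdvd := (isBinaryForm_of_mem_zero_left (pencilDet_mem F G)).dvd_of_mul_eq_sum (by decide)
    hdet (E := E) (A := Sum.elim α β) (r := ![α ⬝ᵥ c, -(α ⬝ᵥ b)]) ?_ ?_
  · obtain ⟨r, hr⟩ : pencilDet F G ∣ α ⬝ᵥ c := hdvd 0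
    obtain ⟨s, hs⟩ : pencilDet F G ∣ -(α ⬝ᵥ b) := hdvd 1
    have hs' : α ⬝ᵥ b = -(pencilDet F G * s) := by rw [← hs, neg_neg]
    have hα' : α = r • a ⨯₃ b + s • a ⨯₃ c := by
      refine smul_right_injective _ hdet ?_
      simp only
      rw [hα, hr, hs']
      module
    have hβ' : β = r • a ⨯₃ c + s • b ⨯₃ c := by
      refine smul_right_injective _ hdet ?_
      simp only
      rw [hβ, hr, hs']
      module
    have hAE : (X 0 : BiRing k) • α + (X 1 : BiRing k) • β =
        r • cubicSyzygy F G 0 + s • cubicSyzygy F G 1 := by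
      rw [hα', hβ']
      simp only [cubicSyzygy, cons_val_zero, cons_val_one]
      module
    rw [hAE]
    exact add_mem (Submodule.smul_mem _ _ (Submodule.subset_span ⟨0, rfl⟩))
      (Submodule.smul_mem _ _ (Submodule.subset_span ⟨1, rfl⟩))
  · intro v hv ρ hρ
    simp only [Fin.sum_univ_two, E, cons_val_zero, cons_val_one] at hρ
    have := (h.isAnisotropic_evalVec v hv).eq_zero_of_cross (r := ρ 0) (s := ρ 1)
      (by rw [← evalVec_cross, ← evalVec_cross]; exact funext fun l => hρ (Sum.inl l))
      (by rw [← evalVec_cross, ← evalVec_cross]; exact funext fun l => hρ (Sum.inr l))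
    funext j
    fin_cases j
    · exact this.1
    · exact this.2
  · rintro (l | l)
    · have := congrFun hα l
      simp [E] at this ⊢
      linear_combination this
    · have := congrFun hβ l
      simp [E] at this ⊢
      linear_combination this

theorem minimalGeneratingSets_of_pencilDet_ne_zero [IsAlgClosed k] (h : IsBasePointFree F G)
    (hdet : pencilDet F G ≠ 0) :
    (∃ S, IsMinimalGeneratingSet (netForm F G) S) ∧
      ∀ S, IsMinimalGeneratingSet (netForm F G) S →
        S.encard = 6 ∧
        {A ∈ S | HasBidegree A (6, 1)}.encard = 1 ∧
        {A ∈ S | HasBidegree A (4, 2)}.encard = 3 ∧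
        {A ∈ S | HasBidegree A (3, 3)}.encard = 2 := by
  have hind := linearIndependent_cubicSyzygy h
  have hcard : (Set.range (cubicSyzygy F G)).encard = 2 := encard_range_fin hind.injective
  have := minimalGeneratingSets_of_low_strands h (V := Set.range (cubicSyzygy F G))
    (Or.inl rfl) (Set.finite_range _) (by rintro _ ⟨j, rfl⟩; exact hasBidegree_cubicSyzygy F G j)
    (by rintro _ ⟨j, rfl⟩; exact cubicSyzygy_mem_Syz F G j) hind.linearIndepOn_id ?_
  · rw [hcard] at this
    exact this
  · intro A hA m n hm hmn
    interval_cases m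
    · obtain ⟨h0, h1, h2⟩ := dotProduct_linCoeff_eq_zero hA hmn
      have hA0 := dotProduct_smul_cross A (linCoeff F G 0) (linCoeff F G 1) (linCoeff F G 2)
      rw [h0, h1, h2, zero_smul, zero_smul, zero_smul, sub_zero, add_zero] at hA0
      rw [(smul_eq_zero.1 hA0).resolve_left hdet]
      exact zero_mem _
    · exact mem_span_cubicSyzygy h hdet hA hmn

theorem minimalGeneratingSets_of_pencilDet_eq_zero [IsAlgClosed k] (h : IsBasePointFree F G)
    (hdet : pencilDet F G = 0) :
    (∃ S, IsMinimalGeneratingSet (netForm F G) S) ∧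
      ∀ S, IsMinimalGeneratingSet (netForm F G) S →
        S.encard = 5 ∧
        {A ∈ S | HasBidegree A (6, 1)}.encard = 1 ∧
        {A ∈ S | HasBidegree A (4, 2)}.encard = 3 ∧
        {A ∈ S | HasBidegree A (2, 3)}.encard = 1 := by
  obtain ⟨N, D, hN, hrel, hD, hab, hac, hbc⟩ := exists_minors_eq_smul h hdet
  set a := linCoeff F G 0 with ha
  set b := linCoeff F G 1 with hb
  set c := linCoeff F G 2 with hc
  have hdet' : a 0 * (b 1 * c 2 - b 2 * c 1) + a 1 * (b 2 * c 0 - b 0 * c 2) +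
      a 2 * (b 0 * c 1 - b 1 * c 0) = 0 := by
    rw [← hdet, pencilDet]
    simp [dotProduct, cross_apply, Fin.sum_univ_three, a, b, c]
  -- Some coefficient of the relation is invertible, so that the corresponding minor is a nonzero
  -- multiple of `D`.
  let M : Fin 3 → Fin 3 → BiRing k := ![b ⨯₃ c, -(a ⨯₃ c), a ⨯₃ b]
  obtain ⟨l, hl⟩ : ∃ l, N l ≠ 0 := by
    by_contra! h0
    exact hN (by simp [h0])
  have hCl : (C (N l) : BiRing k) ≠ 0 := fun h0 => hl (C_eq_zero.1 h0)
  have hM : (C (N l) : BiRing k) • D = M l := by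
    fin_cases l
    · exact hbc.symm
    · change _ = -(a ⨯₃ c)
      rw [hac, neg_smul, neg_neg]
      rfl
    · exact hab.symm
  have hMorth : ∀ l, M l ⬝ᵥ a = 0 ∧ M l ⬝ᵥ b = 0 ∧ M l ⬝ᵥ c = 0 := by
    intro l
    fin_cases l <;> refine ⟨?_, ?_, ?_⟩ <;>
      simp [M, dotProduct, cross_apply, Fin.sum_univ_three] <;>
      first
      | linear_combination hdet'
      | linear_combination -hdet'
      | ring
  have hMcross : ∀ A : Fin 3 → BiRing k, A ⬝ᵥ a = 0 → A ⬝ᵥ b = 0 → A ⬝ᵥ c = 0 →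
      ∀ l, A ⨯₃ M l = 0 := by
    intro A h0 h1 h2 l
    fin_cases l
    · exact cross_cross_eq_zero h1 h2
    · change A ⨯₃ (-(a ⨯₃ c)) = 0
      rw [map_neg, cross_cross_eq_zero h0 h2, neg_zero]
    · exact cross_cross_eq_zero h0 h1
  have hDpt : ∀ v : Fin 4 → k, ¬ (v 2 = 0 ∧ v 3 = 0) → evalVec v D ≠ 0 := by
    intro v hv h0
    have hzero : ∀ r : BiRing k, evalVec v (r • D) = 0 := by
      intro r
      funext i
      have : eval v (D i) = 0 := congrFun h0 i
      simp [evalVec, this]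
    rcases exists_minor_ne_zero h v hv with h1 | h1 <;> apply h1
    · rw [← ha, ← hb, hab, hzero]
    · rw [← ha, ← hc, hac, hzero]
  have hD0 : D ≠ 0 := by
    rintro rfl
    exact hDpt 1 (by simp) (funext fun i => by simp [evalVec])
  have hker : ∀ A : Fin 3 → BiRing k, A ⬝ᵥ a = 0 → A ⬝ᵥ b = 0 → A ⬝ᵥ c = 0 →
      A ∈ Submodule.span (BiRing k) {D} := by
    intro A h0 h1 h2
    have hAD : A ⨯₃ D = 0 := by
      refine (smul_eq_zero.1 (?_ : (C (N l) : BiRing k) • A ⨯₃ D = 0)).resolve_left hCl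
      rw [← map_smul, hM, hMcross A h0 h1 h2]
    obtain ⟨r, hr⟩ := IsBinaryForm.exists_eq_smul (i := 2) (j := 3) (D := D) (A := A) (by decide)
      (fun i => isBinaryForm_of_mem_zero_left (hD i))
      (fun v hv => Function.ne_iff.1 (hDpt v hv))
      (fun i i' => by linear_combination -mul_eq_mul_of_cross_eq_zero hAD i i')
    exact Submodule.mem_span_singleton.2 ⟨r, hr.symm⟩
  have hDS : D ∈ Syz (netForm F G) := by
    have hDM : ∀ u, M l ⬝ᵥ u = 0 → D ⬝ᵥ u = 0 := by
      intro u hu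
      rw [← hM, smul_dotProduct] at hu
      exact (smul_eq_zero.1 hu).resolve_left hCl
    rw [mem_Syz, dotProduct_netForm, hDM _ (hMorth l).1, hDM _ (hMorth l).2.1,
      hDM _ (hMorth l).2.2]
    ring
  have := minimalGeneratingSets_of_low_strands h (V := {D}) (Or.inr rfl) (Set.finite_singleton _)
    (by rintro _ rfl; exact hasBidegree_add_iff.2 hD) (by rintro _ rfl; exact hDS)
    (LinearIndepOn.singleton hD0) ?_
  · rw [Set.encard_singleton] at this
    exact this
  · intro A hA m n hm hmn
    interval_cases m
    · obtain ⟨h0, h1, h2⟩ := dotProduct_linCoeff_eq_zero hA hmn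
      exact hker A h0 h1 h2
    · obtain ⟨α, β, rfl, h0, h1, h2, h3⟩ := exists_eq_X_smul_add hA hmn
      have hN' : (C (N 0 * N 2 - N 1 ^ 2) : BiRing k) ≠ 0 := fun h0 => hN (C_eq_zero.1 h0)
      have hrelα := congrArg (α ⬝ᵥ ·) hrel
      have hrelβ := congrArg (β ⬝ᵥ ·) hrel
      simp only [dotProduct_add, dotProduct_smul, smul_eq_mul, dotProduct_zero] at hrelα hrelβ
      -- Two equations for `α · b` and `α · c`, whose determinant is `N₀ N₂ - N₁²`.
      have hαb : α ⬝ᵥ b = 0 := by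
        refine (mul_eq_zero.1 (?_ : C (N 0 * N 2 - N 1 ^ 2) * (α ⬝ᵥ b) = 0)).resolve_left hN'
        simp only [C_sub, C_mul, C_pow]
        linear_combination -C (N 1) * hrelα - C (N 2) * hrelβ + C (N 1) * C (N 0) * h0 +
          C (N 2) * C (N 0) * h1 + C (N 2) * C (N 1) * h2 + C (N 2) * C (N 2) * h3
      have hαc : α ⬝ᵥ c = 0 := by
        refine (mul_eq_zero.1 (?_ : C (N 0 * N 2 - N 1 ^ 2) * (α ⬝ᵥ c) = 0)).resolve_left hN'
        simp only [C_sub, C_mul, C_pow]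
        linear_combination C (N 0) * hrelα + C (N 1) * hrelβ - C (N 0) * C (N 0) * h0 -
          C (N 1) * C (N 0) * h1 - C (N 1) * C (N 1) * h2 - C (N 1) * C (N 2) * h3
      rw [hαb, zero_add] at h1
      rw [hαc, zero_add] at h2
      exact add_mem (Submodule.smul_mem _ _ (hker α h0 hαb hαc))
        (Submodule.smul_mem _ _ (hker β h1 h2 h3))

end Generators

/-! ### Genericity and the determinant of the pencil -/

section Generic

variable {F G : Fin 3 → Fin 3 → k}

lemma evalVec_netForm (v : Fin 4 → k) (F G : Fin 3 → Fin 3 → k) :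
    evalVec v (netForm F G) = v 0 ^ 2 • (v 2 • F 0 + v 3 • G 0) +
      (v 0 * v 1) • (v 2 • F 1 + v 3 • G 1) + v 1 ^ 2 • (v 2 • F 2 + v 3 • G 2) := by
  funext i
  simp [evalVec, netForm, linCoeff]
  ring

lemma eval_sum_smul (c : Fin 3 → k) (p : Fin 3 → BiRing k) (v : Fin 4 → k) :
    eval v (∑ i, c i • p i) = c ⬝ᵥ evalVec v p := by
  simp [dotProduct, evalVec]

lemma eval_pencilDet (v : Fin 4 → k) : eval v (pencilDet F G) =
    (v 2 • F 0 + v 3 • G 0) ⬝ᵥ (v 2 • F 1 + v 3 • G 1) ⨯₃ (v 2 • F 2 + v 3 • G 2) := by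
  rw [pencilDet, eval_dotProduct, evalVec_cross, evalVec_linCoeff, evalVec_linCoeff,
    evalVec_linCoeff]

/-- The three forms are linearly independent. -/
lemma eq_zero_of_sum_smul_eq_zero [IsAlgClosed k] (h : IsBasePointFree F G) {c : Fin 3 → k}
    (hc : ∑ i, c i • netForm F G i = 0) : c = 0 := by
  have hS : (fun i => C (c i)) ∈ Syz (netForm F G) := by
    rw [mem_Syz, ← hc]
    simp [dotProduct, C_mul']
  have := eq_zero_of_mem_Syz_of_lt h hS (m := 0) (by omega) fun i => C_mem_gradedPiece _
  funext i
  exact C_eq_zero.1 (congrFun this i)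

/-- The combinations of the three forms with coefficients orthogonal to the pencil at the point
`(z : w)`. They are the ones divisible by the linear form vanishing at `(z : w)`. -/
def planeWAt (F G : Fin 3 → Fin 3 → k) (z w : k) :
    Set (Projectivization k (gradedPiece k 2 1)) :=
  {v | ∃ c : Fin 3 → k, (v.rep : BiRing k) = ∑ i, c i • netForm F G i ∧
    ∀ j, c ⬝ᵥ (z • F j + w • G j) = 0}

lemma coe_rep_ne_zero (v : Projectivization k (gradedPiece k 2 1)) : (v.rep : BiRing k) ≠ 0 :=
  fun h => v.rep_nonzero (Subtype.ext h)

/-- The pencil has rank at least two at every point, so the coefficients are unique up to a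
scalar. -/
lemma subsingleton_planeWAt [IsAlgClosed k] (h : IsBasePointFree F G) {z w : k}
    (hzw : ¬ (z = 0 ∧ w = 0)) : (planeWAt F G z w).Subsingleton := by
  obtain ⟨M, hM0, hM⟩ : ∃ M : Fin 3 → k, M ≠ 0 ∧ ∀ c : Fin 3 → k,
      (∀ j, c ⬝ᵥ (z • F j + w • G j) = 0) → c ⨯₃ M = 0 := by
    by_cases h01 : (z • F 0 + w • G 0) ⨯₃ (z • F 1 + w • G 1) = 0
    · exact ⟨_, fun h02 => (h z w hzw).cross_ne_zero h01 h02,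
        fun c hc => cross_cross_eq_zero (hc 0) (hc 2)⟩
    · exact ⟨_, h01, fun c hc => cross_cross_eq_zero (hc 0) (hc 1)⟩
  rintro v ⟨c, hv, hc⟩ v' ⟨c', hv', hc'⟩
  obtain ⟨s, rfl⟩ := exists_eq_smul_of_cross_eq_zero hM0 (hM c hc)
  obtain ⟨s', rfl⟩ := exists_eq_smul_of_cross_eq_zero hM0 (hM c' hc')
  have hs' : s' ≠ 0 := by
    rintro rfl
    exact coe_rep_ne_zero v' (by rw [hv']; simp)
  rw [← v.mk_rep, ← v'.mk_rep, Projectivization.mk_eq_mk_iff']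
  refine ⟨s / s', Subtype.ext ?_⟩
  rw [Submodule.coe_smul, hv, hv', Finset.smul_sum]
  refine Finset.sum_congr rfl fun i _ => ?_
  rw [smul_smul, Pi.smul_apply, Pi.smul_apply, smul_eq_mul, smul_eq_mul, ← mul_assoc,
    div_mul_cancel₀ _ hs']

lemma mem_planeWAt {v : Projectivization k (gradedPiece k 2 1)} {c : Fin 3 → k} {z w : k}
    (hv : (v.rep : BiRing k) = ∑ i, c i • netForm F G i)
    (hvan : ∀ x y, eval ![x, y, z, w] (v.rep : BiRing k) = 0) : v ∈ planeWAt F G z w := by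
  refine ⟨c, hv, ?_⟩
  have key : ∀ x y, x ^ 2 * (c ⬝ᵥ (z • F 0 + w • G 0)) +
      x * y * (c ⬝ᵥ (z • F 1 + w • G 1)) + y ^ 2 * (c ⬝ᵥ (z • F 2 + w • G 2)) = 0 := by
    intro x y
    rw [← hvan x y, hv, eval_sum_smul, evalVec_netForm]
    simp only [cons_val_zero, cons_val_one, cons_val, dotProduct_add, dotProduct_smul, smul_eq_mul]
  have h0 := key 1 0
  have h2 := key 0 1
  have h1 := key 1 1
  simp only [one_pow, one_mul, mul_one, zero_mul, mul_zero, add_zero, zero_add, ne_eq,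
    OfNat.ofNat_ne_zero, not_false_eq_true, zero_pow] at h0 h1 h2
  rw [h0, h2, zero_add, add_zero] at h1
  intro j
  fin_cases j
  · exact h0
  · exact h1
  · exact h2

lemma eval_pencilDet_eq_zero_of_mem {z w : k} {v : Projectivization k (gradedPiece k 2 1)}
    (hv : v ∈ planeWAt F G z w) : eval ![0, 0, z, w] (pencilDet F G) = 0 := by
  obtain ⟨c, hvc, hc⟩ := hv
  have hc0 : c ≠ 0 := by
    rintro rfl
    exact coe_rep_ne_zero v (by rw [hvc]; simp)
  have := dotProduct_smul_cross c (z • F 0 + w • G 0) (z • F 1 + w • G 1) (z • F 2 + w • G 2)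
  rw [hc, hc, hc, zero_smul, zero_smul, zero_smul, sub_zero, add_zero] at this
  rw [eval_pencilDet]
  exact (smul_eq_zero.1 this).resolve_right hc0

/-- A point of `W(p) ∩ Y` is a multiple of a linear form in `z, w`, whose zero is a root of the
determinant and determines the point. -/
lemma isGeneric_of_pencilDet_ne_zero [IsAlgClosed k] (h : IsBasePointFree F G)
    (hdet : pencilDet F G ≠ 0) : IsGeneric (netForm F G) := by
  let φ : Polynomial k := aeval ![0, 0, 1, Polynomial.X] (pencilDet F G)
  have hφ : ∀ t, φ.eval t = eval ![0, 0, 1, t] (pencilDet F G) := by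
    intro t
    rw [polynomial_eval_aeval_eq]
    congr 2
    funext l
    fin_cases l <;> simp
  have hφ0 : φ ≠ 0 := by
    intro h0
    refine hdet (eq_of_eval_eq_of_ne_zero 2 fun v hv => ?_)
    have h1 := eval_smul_of_mem (pencilDet_mem F G) 1 (v 2) ![0, 0, 1, v 3 / v 2]
    rw [← hφ, h0, Polynomial.eval_zero, mul_zero] at h1
    rw [map_zero, ← h1]
    refine eval_of_mem_zero_left (pencilDet_mem F G) _ _ ?_ ?_
    · simp
    · simp [mul_div_cancel₀ _ hv]
  have hfin : ((⋃ t ∈ {t | φ.IsRoot t}, planeWAt F G 1 t) ∪ planeWAt F G 0 1).Finite :=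
    ((Polynomial.finite_setOfPred_isRoot hφ0).biUnion fun t _ =>
      (subsingleton_planeWAt h (by simp)).finite).union (subsingleton_planeWAt h (by simp)).finite
  refine hfin.subset ?_
  rintro v ⟨hW, q, hq, l, hl, hql⟩
  obtain ⟨c, hc⟩ := (Submodule.mem_span_range_iff_exists_fun k).1 hW
  obtain ⟨s, t, rfl⟩ := exists_eq_linear hl
  have hmem : ∀ z w, s * z + t * w = 0 → v ∈ planeWAt F G z w := by
    intro z w hzw
    refine mem_planeWAt hc.symm fun x y => ?_
    rw [hql]
    simp [hzw]
  by_cases ht : t = 0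
  · exact Or.inr (hmem 0 1 (by simp [ht]))
  · have h1 := hmem 1 (-s / t) (by field_simp; ring)
    refine Or.inl (Set.mem_biUnion (x := -s / t) ?_ h1)
    change φ.eval _ = 0
    rw [hφ]
    exact eval_pencilDet_eq_zero_of_mem h1

/-- If the determinant vanishes, then every point `(1 : t)` is the zero of a linear form with a
multiple in the span of the three forms, and these multiples are pairwise independent. -/
lemma not_isGeneric_of_pencilDet_eq_zero [IsAlgClosed k] (h : IsBasePointFree F G)
    (hdet : pencilDet F G = 0) : ¬ IsGeneric (netForm F G) := by
  have hex : ∀ t : k, ∃ c : Fin 3 → k, c ≠ 0 ∧ ∀ j, c ⬝ᵥ (F j + t • G j) = 0 := by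
    intro t
    have h1 := eval_pencilDet (F := F) (G := G) ![0, 0, 1, t]
    rw [hdet, map_zero, triple_product_eq_det] at h1
    obtain ⟨c, hc0, hc⟩ := exists_mulVec_eq_zero_iff.2 h1.symm
    refine ⟨c, hc0, fun j => ?_⟩
    have key : ((![0, 0, 1, t] : Fin 4 → k) 2 • F j + (![0, 0, 1, t] : Fin 4 → k) 3 • G j) ⬝ᵥ c =
        0 := by
      fin_cases j
      · exact congrFun hc 0
      · exact congrFun hc 1
      · exact congrFun hc 2
    simp only [cons_val, one_smul] at key
    rwa [dotProduct_comm]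
  choose c hc0 hc using hex
  have hmem : ∀ t, ∑ i, c t i • netForm F G i ∈ gradedPiece k 2 1 := fun t =>
    Submodule.sum_mem _ fun i _ => Submodule.smul_mem _ _ (netForm_mem F G i)
  have hne : ∀ t, (⟨_, hmem t⟩ : gradedPiece k 2 1) ≠ 0 := fun t h0 =>
    hc0 t (eq_zero_of_sum_smul_eq_zero h (congrArg Subtype.val h0))
  refine Set.infinite_of_injective_forall_mem
    (f := fun t => Projectivization.mk k ⟨_, hmem t⟩ (hne t)) ?_ ?_
  · intro t u htu
    by_contra hne'
    obtain ⟨s, hs⟩ := (Projectivization.mk_eq_mk_iff' _ _ _ _ _).1 htu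
    have hs1 := congrArg Subtype.val hs
    rw [Submodule.coe_smul] at hs1
    have hcs : s • c u - c t = 0 := by
      refine eq_zero_of_sum_smul_eq_zero h ?_
      simp only [Pi.sub_apply, Pi.smul_apply, smul_eq_mul, sub_smul, mul_smul,
        Finset.sum_sub_distrib, ← Finset.smul_sum]
      exact sub_eq_zero.2 hs1
    have hct : c t = s • c u := (sub_eq_zero.1 hcs).symm
    have hG : ∀ j, c t ⬝ᵥ G j = 0 := by
      intro j
      have h1 := hc t j
      have h2 : c t ⬝ᵥ (F j + u • G j) = 0 := by rw [hct, smul_dotProduct, hc u j, smul_zero]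
      rw [dotProduct_add, dotProduct_smul, smul_eq_mul] at h1 h2
      have h3 : (t - u) * (c t ⬝ᵥ G j) = 0 := by linear_combination h1 - h2
      exact (mul_eq_zero.1 h3).resolve_left (sub_ne_zero.2 hne')
    have hF : ∀ j, c t ⬝ᵥ F j = 0 := by
      intro j
      have h1 := hc t j
      rwa [dotProduct_add, dotProduct_smul, hG, smul_zero, add_zero] at h1
    refine hc0 t (eq_zero_of_sum_smul_eq_zero h (MvPolynomial.funext fun v => ?_))
    rw [eval_sum_smul, evalVec_netForm]
    simp only [dotProduct_add, dotProduct_smul, hF, hG, smul_zero, add_zero, map_zero]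
  · intro t
    obtain ⟨a, ha⟩ := Projectivization.exists_smul_eq_mk_rep k
      (⟨_, hmem t⟩ : gradedPiece k 2 1) (hne t)
    have ha1 := (congrArg Subtype.val ha).symm
    rw [Submodule.coe_smul_of_tower] at ha1
    constructor
    · change ((Projectivization.mk k (⟨_, hmem t⟩ : gradedPiece k 2 1) (hne t)).rep : BiRing k) ∈
        Submodule.span k (Set.range (netForm F G))
      rw [ha1, Units.smul_def]
      have hspan : ∑ i, c t i • netForm F G i ∈ Submodule.span k (Set.range (netForm F G)) :=
        Submodule.sum_mem _ fun i _ =>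
          Submodule.smul_mem _ _ (Submodule.subset_span (Set.mem_range_self i))
      exact Submodule.smul_mem _ _ hspan
    · let q : BiRing k := C (c t ⬝ᵥ G 0) * X 0 ^ 2 + C (c t ⬝ᵥ G 1) * (X 0 * X 1) +
        C (c t ⬝ᵥ G 2) * X 1 ^ 2
      have hq : q ∈ gradedPiece k 2 0 :=
        quadForm_mem (fun j _ => c t ⬝ᵥ G j) 0
      have hl : C (-t) * X 2 + C 1 * X 3 ∈ gradedPiece k 0 1 :=
        linCoeff_mem (fun _ _ => -t) (fun _ _ => 1) 0 0
      refine ⟨C (a : k) * q, C_mul_mem_gradedPiece _ hq, _, hl, ?_⟩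
      rw [ha1, Units.smul_def, smul_eq_C_mul, mul_assoc]
      congr 1
      refine MvPolynomial.funext fun v => ?_
      have hFG : ∀ j, c t ⬝ᵥ F j = -(t * (c t ⬝ᵥ G j)) := by
        intro j
        have := hc t j
        rw [dotProduct_add, dotProduct_smul, smul_eq_mul] at this
        linear_combination this
      rw [eval_sum_smul, evalVec_netForm]
      simp only [dotProduct_add, dotProduct_smul, hFG, smul_eq_mul, q, map_add, map_mul, eval_C,
        eval_X, map_pow]
      ring

end Generic

end BigradedSyzygy

open BigradedSyzygy in
theorem proposition5p2 {k : Type*} [Field k] [IsAlgClosed k] (p : Fin 3 → BiRing k)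
    (hp : ∀ i, p i ∈ gradedPiece k 2 1) (hzero : NoCommonZeros p) :
    (IsGeneric p →
      (∃ S, IsMinimalGeneratingSet p S) ∧
      ∀ S, IsMinimalGeneratingSet p S →
        S.encard = 6 ∧
        {A ∈ S | HasBidegree A (6, 1)}.encard = 1 ∧
        {A ∈ S | HasBidegree A (4, 2)}.encard = 3 ∧
        {A ∈ S | HasBidegree A (3, 3)}.encard = 2) ∧
    (¬ IsGeneric p →
      (∃ S, IsMinimalGeneratingSet p S) ∧
      ∀ S, IsMinimalGeneratingSet p S →
        S.encard = 5 ∧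
        {A ∈ S | HasBidegree A (6, 1)}.encard = 1 ∧
        {A ∈ S | HasBidegree A (4, 2)}.encard = 3 ∧
        {A ∈ S | HasBidegree A (2, 3)}.encard = 1) := by
  obtain ⟨F, G, rfl⟩ := exists_eq_netForm hp
  have h := isBasePointFree_of_noCommonZeros hzero
  constructor
  · intro hgen
    exact minimalGeneratingSets_of_pencilDet_ne_zero h
      fun hdet => not_isGeneric_of_pencilDet_eq_zero h hdet hgen
  · intro hgen
    refine minimalGeneratingSets_of_pencilDet_eq_zero h ?_
    by_contra hdet
    exact hgen (isGeneric_of_pencilDet_ne_zero h hdet)
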